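/- Let $n,d\ge 0$ be integers. Let $\widetilde G^n_d$ be the oriented Grassmannian of oriented $d$-dimensional linear subspaces of $\mathbb{R}^n$, identified through $T\mapsto \frac{u_1\wedge\cdots\wedge u_d}{|u_1\wedge\cdots\wedge u_d|}$ ($u$ an oriented basis of $T$) with a compact submanifold of the unit sphere of $\Lambda^d(\mathbb{R}^n)$, where $\langle \xi_1\wedge\cdots\wedge\xi_d,\eta_1\wedge\cdots\wedge\eta_d\rangle=\det(\xi_i\cdot\eta_j)$. An oriented $d$-varifold is a nonnegative finite Borel measure $\mu$ on $\mathbb{R}^n\times\widetilde G^n_d$, and $(\mu|\omega)=\int\omega\,d\mu$. For a $C^1$-diffeomorphism $\varphi$ of $\mathbb{R}^n$ the pushforward varifold $\varphi_\#\mu$ is given by $$(\varphi_\#\mu|\omega)=\int \omega\big(\varphi(x),d_x\varphi\cdot T\big)\,J_T\varphi(x)\,d\mu(x,T),$$ where $A\cdot T=\frac{Au_1\wedge\cdots\wedge Au_d}{|Au_1\wedge\cdots\wedge Au_d|}$ and $J_T\varphi(x)=|d_x\varphi(e_1)\wedge\cdots\wedge d_x\varphi(e_d)|=\sqrt{\det\big(d_x\varphi(e_i)\cdot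 d_x\varphi(e_j)\big)_{i,j}}$ for an orthonormal basis $(e_i)$ of $T$. Let $V$ be a reproducing kernel Hilbert space of vector fields on $\mathbb{R}^n$ that is continuously embedded in $C_0^2(\mathbb{R}^n,\mathbb{R}^n)$, and let $W$ be a real reproducing kernel Hilbert space of functions on $\mathbb{R}^n\times\widetilde G^n_d$ that is continuously embedded in $C_0^1(\mathbb{R}^n\times\widetilde G^n_d)$ (here $C_0^k$ is the space of $C^k$ functions that vanish at infinity together with their derivatives up to order $k$, with the norm $\|\cdot\|_{k,\infty}$). Let $\mu_0,\mu_{tar}$ be oriented $d$-varifolds, with $\operatorname{supp}(\mu_0)$ contained in a compact subset $K$ of $\mathbb{R}^n\times\widetilde G^n_d$, and let $\lambda\ge 0$. Then every $v\in L^2([0,1],V)$ has a unique flow $(\varphi^v_t)_{t\in[0,1]}$, that is, $\varphi^v_t(x)=x+\int_0^t v_s(\varphi^v_s(x))\,ds$ for all $x\in\mathbb{R}^n$ and $t\in[0,1]$, and the functional $$E(v)=\frac12\int_0^1\|v_t\|_V^2\,dt+\lambda\,\big\|(\varphi^v_1)_\#\mu_0-\mu_{tar}\big\|_{W^*}^2,\qquad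 \|L\|_{W^*}=\sup_{\omega\in W,\ \|\omega\|_W\le 1}|(L|\omega)|,$$ has a global minimizer on $L^2([0,1],V)$, with a finite minimum: there is $\bar v\in L^2([0,1],V)$ with $E(\bar v)<\infty$ and $E(\bar v)\le E(v)$ for all $v\in L^2([0,1],V)$. -/

import Mathlib

open MeasureTheory Set Filter Topology
open scoped ENNReal NNReal

noncomputable section

namespace Varifold

/-- The Euclidean space `ℝⁿ`. -/
abbrev Eucl (n : ℕ) : Type := EuclideanSpace ℝ (Fin n)

/-- The space `Λ^d(ℝⁿ)` of `d`-vectors, with Mathlib's Hilbert structure, for which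
`⟪ξ₁ ∧ ⋯ ∧ ξ_d, η₁ ∧ ⋯ ∧ η_d⟫ = det (ξᵢ · ηⱼ)`. -/
abbrev MultiVec (n d : ℕ) : Type := ⋀[ℝ]^d (Eucl n)

/-- The wedge product `u₁ ∧ ⋯ ∧ u_d`. -/
abbrev wedge {n d : ℕ} (u : Fin d → Eucl n) : MultiVec n d := exteriorPower.ιMulti ℝ d u

/-- The oriented Grassmannian as a subset of the unit sphere of `Λ^d(ℝⁿ)`, through the oriented
Plücker embedding: the unit multiples of decomposable `d`-vectors. For `d ≥ 1` the scalar `c` can be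
absorbed into a vector; it is there so that `d = 0` yields both orientations of the zero subspace. -/
def grassmannSet (n d : ℕ) : Set (MultiVec n d) :=
  {ξ | ‖ξ‖ = 1 ∧ ∃ (c : ℝ) (u : Fin d → Eucl n), ξ = c • wedge u}

/-- The oriented Grassmannian `G̃ⁿ_d`, with the topology and metric inherited from `Λ^d(ℝⁿ)`. -/
abbrev OrientedGrassmannian (n d : ℕ) : Type := grassmannSet n d

instance instMeasurableSpaceGrassmannian (n d : ℕ) :
    MeasurableSpace (OrientedGrassmannian n d) := borel _

instance instBorelSpaceGrassmannian (n d : ℕ) : BorelSpace (OrientedGrassmannian n d) := ⟨rfl⟩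

/-- The phase space `ℝⁿ × G̃ⁿ_d`. An oriented `d`-varifold is a finite Borel measure on it. -/
abbrev PhaseSpace (n d : ℕ) : Type := Eucl n × OrientedGrassmannian n d

/-- The map `Λ^d A` induced on `d`-vectors by a linear map `A`:
`u₁ ∧ ⋯ ∧ u_d ↦ A u₁ ∧ ⋯ ∧ A u_d`. -/
def wedgeMap {n : ℕ} (d : ℕ) (A : Eucl n →L[ℝ] Eucl n) : MultiVec n d →ₗ[ℝ] MultiVec n d :=
  exteriorPower.map d (A : Eucl n →ₗ[ℝ] Eucl n)

lemma wedgeMap_wedge {n d : ℕ} (A : Eucl n →L[ℝ] Eucl n) (u : Fin d → Eucl n) :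
    wedgeMap d A (wedge u) = wedge (fun i => A (u i)) :=
  exteriorPower.map_apply_ιMulti _ _

lemma normalize_mem_grassmannSet {n d : ℕ} (A : Eucl n →L[ℝ] Eucl n)
    (T : OrientedGrassmannian n d) (h : wedgeMap d A T.1 ≠ 0) :
    ‖wedgeMap d A T.1‖⁻¹ • wedgeMap d A T.1 ∈ grassmannSet n d := by
  obtain ⟨ξ, hξ, c, u, rfl⟩ := T
  refine ⟨?_, ‖wedgeMap d A (c • wedge u)‖⁻¹ * c, fun i => A (u i), ?_⟩
  · rw [norm_smul, norm_inv, norm_norm, inv_mul_cancel₀ (norm_ne_zero_iff.mpr h)]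
  · rw [map_smul, wedgeMap_wedge, smul_smul]

open Classical in
/-- The action of a linear map on the oriented Grassmannian,
`A · T = (A u₁ ∧ ⋯ ∧ A u_d) / |A u₁ ∧ ⋯ ∧ A u_d|`. It is meant for invertible `A`; if `Λ^d A`
kills `T` the value is `T`. -/
def grassmannAct {n d : ℕ} (A : Eucl n →L[ℝ] Eucl n) (T : OrientedGrassmannian n d) :
    OrientedGrassmannian n d :=
  if h : wedgeMap d A T.1 ≠ 0 then
    ⟨‖wedgeMap d A T.1‖⁻¹ • wedgeMap d A T.1, normalize_mem_grassmannSet A T h⟩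
  else T

/-- The Jacobian of `A` along `T`, i.e. the change of `d`-volume induced by `A` along `T`:
`|A e₁ ∧ ⋯ ∧ A e_d|` for an orthonormal basis `e` of `T`. -/
def jacobianAlong {n d : ℕ} (A : Eucl n →L[ℝ] Eucl n) (T : OrientedGrassmannian n d) : ℝ :=
  ‖wedgeMap d A T.1‖

/-- The Jacobian along `T` is the square root of the Gram determinant of the images of a basis
that represents `T`. -/
lemma jacobianAlong_eq_sqrt_det {n d : ℕ} (A : Eucl n →L[ℝ] Eucl n)
    (T : OrientedGrassmannian n d) (e : Fin d → Eucl n) (he : T.1 = wedge e) :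
    jacobianAlong A T =
      √(Matrix.det (Matrix.of fun i j => inner ℝ (A (e i)) (A (e j)))) := by
  have h := exteriorPower.inner_ιMulti_self (fun i => A (e i))
  rw [jacobianAlong, he, wedgeMap_wedge, norm_eq_sqrt_real_inner, h]
  rfl

/-! ### Function spaces -/

/-- `f ∈ C₀²(ℝⁿ, ℝⁿ)`: twice continuously differentiable, all derivatives of order at most two
vanishing at infinity. -/
def IsC02 {n : ℕ} (f : Eucl n → Eucl n) : Prop :=
  ContDiff ℝ 2 f ∧
    ∀ k ≤ 2, Tendsto (fun x => ‖iteratedFDeriv ℝ k f x‖) (cocompact (Eucl n)) (𝓝 0)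

/-- The Hilbert space `V` of vector fields is continuously embedded in `C₀²(ℝⁿ, ℝⁿ)`. -/
def EmbedsInC02 (n : ℕ) (V : Type*) [NormedAddCommGroup V] [InnerProductSpace ℝ V]
    [RKHS ℝ V (Eucl n) (Eucl n)] : Prop :=
  (∀ v : V, IsC02 (v : Eucl n → Eucl n)) ∧
    ∃ c : ℝ, ∀ v : V, ∀ k ≤ 2, ∀ x : Eucl n,
      ‖iteratedFDeriv ℝ k (v : Eucl n → Eucl n) x‖ ≤ c * ‖v‖

/-- `ℝⁿ × G̃ⁿ_d` as an embedded submanifold of the vector space `ℝⁿ × Λ^d(ℝⁿ)`. -/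
def phaseSet (n d : ℕ) : Set (Eucl n × MultiVec n d) := {p | p.2 ∈ grassmannSet n d}

/-- A point of `ℝⁿ × G̃ⁿ_d` in the ambient vector space. -/
def ambient {n d : ℕ} (p : PhaseSpace n d) : Eucl n × MultiVec n d := (p.1, p.2.1)

open Classical in
/-- A function on `ℝⁿ × G̃ⁿ_d` seen as a function on the ambient space; only its values on
`phaseSet` are ever used. -/
def toAmbient {n d : ℕ} (ω : PhaseSpace n d → ℝ) : Eucl n × MultiVec n d → ℝ :=
  fun p => if h : p.2 ∈ grassmannSet n d then ω (p.1, ⟨p.2, h⟩) else 0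

/-- The norm `|dω(p)|` of the differential of `ω` on the tangent space of `ℝⁿ × G̃ⁿ_d` at `p`.
Derivatives within `phaseSet` are determined exactly on the tangent space. -/
def diffNorm {n d : ℕ} (ω : PhaseSpace n d → ℝ) (p : PhaseSpace n d) : ℝ≥0∞ :=
  ⨆ y ∈ tangentConeAt ℝ (phaseSet n d) (ambient p) ∩ Metric.closedBall 0 1,
    ‖fderivWithin ℝ (toAmbient ω) (phaseSet n d) (ambient p) y‖ₑ

/-- `ω ∈ C₀¹(ℝⁿ × G̃ⁿ_d)`: continuously differentiable, `ω` and `dω` vanishing at infinity. -/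
def IsC01 {n d : ℕ} (ω : PhaseSpace n d → ℝ) : Prop :=
  ContDiffOn ℝ 1 (toAmbient ω) (phaseSet n d) ∧
    Tendsto ω (cocompact (PhaseSpace n d)) (𝓝 0) ∧
    Tendsto (diffNorm ω) (cocompact (PhaseSpace n d)) (𝓝 0)

/-- The Hilbert space `W` of functions is continuously embedded in `C₀¹(ℝⁿ × G̃ⁿ_d)`. -/
def EmbedsInC01 (n d : ℕ) (W : Type*) [NormedAddCommGroup W] [InnerProductSpace ℝ W]
    [RKHS ℝ W (PhaseSpace n d) ℝ] : Prop :=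
  (∀ ω : W, IsC01 (ω : PhaseSpace n d → ℝ)) ∧
    ∃ c : ℝ≥0, ∀ ω : W, ∀ p : PhaseSpace n d,
      ‖ω p‖ₑ ≤ c * ‖ω‖ₑ ∧ diffNorm (ω : PhaseSpace n d → ℝ) p ≤ c * ‖ω‖ₑ

/-! ### Varifolds as functionals, pushforward, dual metric -/

/-- The duality bracket `(μ | ω)`. -/
def pairing {n d : ℕ} (μ : Measure (PhaseSpace n d)) (ω : PhaseSpace n d → ℝ) : ℝ :=
  ∫ p, ω p ∂μ

/-- The pushforward action, `(φ_# μ | ω) = ∫ ω(φ(x), d_xφ · T) J_Tφ(x) dμ(x, T)`. -/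
def pushforward {n d : ℕ} (φ : Eucl n → Eucl n) (μ : Measure (PhaseSpace n d))
    (ω : PhaseSpace n d → ℝ) : ℝ :=
  ∫ p, ω (φ p.1, grassmannAct (fderiv ℝ φ p.1) p.2) * jacobianAlong (fderiv ℝ φ p.1) p.2 ∂μ

/-- The norm of `W*`, of a functional on functions restricted to `W`: the supremum of its absolute
values over the unit ball of `W`. -/
def dualNorm {n d : ℕ} (W : Type*) [NormedAddCommGroup W] [InnerProductSpace ℝ W]
    [RKHS ℝ W (PhaseSpace n d) ℝ] (L : (PhaseSpace n d → ℝ) → ℝ) : ℝ≥0∞ :=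
  ⨆ ω ∈ Metric.closedBall (0 : W) 1, ‖L (ω : PhaseSpace n d → ℝ)‖ₑ

/-! ### Flows and the registration functional -/

/-- Time-dependent velocity fields, `L²([0,1], V)`. -/
abbrev Velocity (V : Type*) [NormedAddCommGroup V] : Type _ :=
  Lp V 2 (volume.restrict (Icc (0 : ℝ) 1))

section

variable {n : ℕ} {V : Type*} [NormedAddCommGroup V] [InnerProductSpace ℝ V]
  [RKHS ℝ V (Eucl n) (Eucl n)]

/-- `φ` is a flow of `v` on `[0,1]`: `φ₀ = id` and `∂ₜφ = vₜ ∘ φₜ`, in integrated form (`v` is only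
square integrable in time, so trajectories are absolutely continuous). -/
def IsFlow (v : Velocity V) (φ : ℝ → Eucl n → Eucl n) : Prop :=
  ∀ x : Eucl n, IntervalIntegrable (fun s => (v s : V) (φ s x)) volume 0 1 ∧
    ∀ t ∈ Icc (0 : ℝ) 1, φ t x = x + ∫ s in (0 : ℝ)..t, (v s : V) (φ s x)

open Classical in
/-- The flow map `t ↦ φₜᵛ` of `v` (its values for `t ∉ [0,1]` are irrelevant). -/
def flow (v : Velocity V) : ℝ → Eucl n → Eucl n :=
  if h : ∃ φ : ℝ → Eucl n → Eucl n, IsFlow v φ then h.choose else fun _ x => x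

/-- The registration functional
`E(v) = 1/2 ∫₀¹ ‖vₜ‖² dt + lam ‖(φ₁ᵛ)_# μ₀ - μtar‖²_{W*}`. -/
def energy {d : ℕ} (W : Type*) [NormedAddCommGroup W] [InnerProductSpace ℝ W]
    [RKHS ℝ W (PhaseSpace n d) ℝ] (lam : ℝ≥0) (μ₀ μtar : Measure (PhaseSpace n d))
    (v : Velocity V) : ℝ≥0∞ :=
  1 / 2 * (∫⁻ t in Icc (0 : ℝ) 1, ‖v t‖ₑ ^ 2) +
    lam * dualNorm W (fun ω => pushforward (flow v 1) μ₀ ω - pairing μtar ω) ^ 2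

end

end Varifold

end

noncomputable section

namespace Varifold

/-! ### Grönwall inequalities with a square integrable coefficient -/

/-! The proof is the direct method. The energy is finite, and half the squared `L²` norm is one of
its terms, so a minimizing sequence is bounded and has a weakly convergent subsequence
(`exists_weakly_convergent_subseq`). It remains to show that the energy is weakly sequentially lower
semicontinuous (`C2Bound.energy_le_of_tendsto`).

The norm term is handled by its tangent lower bound. The data term is a supremum over test
functions, so it is enough that each bracket with the transported varifold is weakly continuous. For
this, weak convergence of velocities gives pointwise convergence of the flows at time 1
(`C2Bound.tendsto_flow`): along the limit trajectory the integrated velocity is a bounded linear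
functional, and Grönwall absorbs the nonlinear rest. The differentials converge too
(`C2Bound.tendsto_fderiv_flow`), because the bound on second derivatives gives the flows a Taylor
remainder that is quadratic, uniformly on bounded sets of velocities. Dominated convergence
concludes: the integrand is jointly continuous in point, differential and plane
(`continuous_pushforward_integrand`), also where the differential degenerates, so invertibility of
the flow is never needed.

Velocities are only square integrable in time. Grönwall and Picard are therefore applied to squares,
where Cauchy-Schwarz turns the time-dependent Lipschitz constant into a constant coefficient. -/

/-- Cauchy-Schwarz inequality for the integral of a product. -/
lemma sq_integral_mul_le {α : Type*} [MeasurableSpace α] {μ : Measure α} {f g : α → ℝ}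
    (hf : MemLp f 2 μ) (hg : MemLp g 2 μ) :
    (∫ a, f a * g a ∂μ) ^ 2 ≤ (∫ a, f a ^ 2 ∂μ) * ∫ a, g a ^ 2 ∂μ := by
  have hfg : Integrable (fun a => f a * g a) μ := hf.integrable_mul hg
  -- The integral of `(x f + g)²` is a nonnegative quadratic in `x`, so its discriminant is
  -- nonpositive.
  have key : ∀ x : ℝ, 0 ≤ (∫ a, f a ^ 2 ∂μ) * (x * x) + (2 * ∫ a, f a * g a ∂μ) * x
      + ∫ a, g a ^ 2 ∂μ := by
    intro x
    have h1 : ∫ a, (x * f a + g a) ^ 2 ∂μ = (∫ a, f a ^ 2 ∂μ) * (x * x)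
        + (2 * ∫ a, f a * g a ∂μ) * x + ∫ a, g a ^ 2 ∂μ := by
      have : (fun a => (x * f a + g a) ^ 2)
          = fun a => (x * x) * f a ^ 2 + (2 * x) * (f a * g a) + g a ^ 2 := by
        funext a; ring
      have h2 : Integrable (fun a => (x * x) * f a ^ 2 + (2 * x) * (f a * g a)) μ :=
        (hf.integrable_sq.const_mul _).add (hfg.const_mul _)
      rw [this, integral_add h2 hg.integrable_sq,
        integral_add (hf.integrable_sq.const_mul _) (hfg.const_mul _),
        integral_const_mul, integral_const_mul]
      ring
    rw [← h1]
    exact integral_nonneg fun a => sq_nonneg _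
  have := discrim_le_zero key
  unfold discrim at this
  nlinarith

/-- Grönwall's inequality in integral form with a constant coefficient. -/
lemma le_mul_exp_of_le_add_integral {w : ℝ → ℝ} {A B : ℝ} (hw : ContinuousOn w (Icc 0 1))
    (hB : 0 ≤ B) (h : ∀ t ∈ Icc (0 : ℝ) 1, w t ≤ A + B * ∫ s in (0 : ℝ)..t, w s) :
    ∀ t ∈ Icc (0 : ℝ) 1, w t ≤ A * Real.exp (B * t) := by
  -- `w` is merely continuous, whereas `F` has the right derivative `B w ≤ B F`; the differential
  -- form of Grönwall applies to `F`.
  set F : ℝ → ℝ := fun t => A + B * ∫ s in (0 : ℝ)..t, w s with hF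
  have hint : IntegrableOn w (Icc 0 1) := hw.integrableOn_Icc
  have hFc : ContinuousOn F (Icc 0 1) := by
    have := intervalIntegral.continuousOn_primitive_interval (a := 0) (b := 1)
      (by rwa [uIcc_of_le zero_le_one])
    rw [uIcc_of_le zero_le_one] at this
    exact continuousOn_const.add (continuousOn_const.mul this)
  have hd : ∀ t ∈ Ico (0 : ℝ) 1, HasDerivWithinAt F (B * w t) (Ici t) t := by
    intro t ht
    have hi : IntervalIntegrable w volume 0 t :=
      (hw.mono (by rw [uIcc_of_le ht.1]; exact Icc_subset_Icc_right ht.2.le)).intervalIntegrable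
    have hmem : Icc 0 1 ∈ 𝓝[>] t :=
      mem_of_superset (Ioc_mem_nhdsGT ht.2) fun s hs => ⟨ht.1.trans hs.1.le, hs.2⟩
    have hm : StronglyMeasurableAtFilter w (𝓝[>] t) :=
      ⟨Icc 0 1, hmem, hint.aestronglyMeasurable⟩
    have hc : ContinuousWithinAt w (Ioi t) t :=
      (hw t ⟨ht.1, ht.2.le⟩).mono_of_mem_nhdsWithin hmem
    exact ((intervalIntegral.integral_hasDerivWithinAt_right hi hm hc).const_mul B).const_add A
  have hG := le_gronwallBound_of_liminf_deriv_right_le (f := F) (f' := fun t => B * w t)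
    (δ := A) (K := B) (ε := 0) hFc
    (fun t ht r hr => (hd t ht).liminf_right_slope_le hr)
    (by simp [hF])
    (fun t ht => by
      have := mul_le_mul_of_nonneg_left (h t ⟨ht.1, ht.2.le⟩) hB
      simpa [hF] using this)
  intro t ht
  have := hG t ht
  rw [gronwallBound_ε0, sub_zero] at this
  exact (h t ht).trans this

section

variable {κ : ℝ → ℝ} {R : ℝ}

lemma memLp_two_of_continuousOn {g : ℝ → ℝ} (hg : ContinuousOn g (Icc 0 1)) {t : ℝ}
    (ht : t ∈ Icc (0 : ℝ) 1) : MemLp g 2 (volume.restrict (Ioc 0 t)) := by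
  have hsub : Ioc 0 t ⊆ Icc (0 : ℝ) 1 := fun s hs => ⟨hs.1.le, hs.2.trans ht.2⟩
  have h2 : IntegrableOn g (Icc 0 1) := hg.integrableOn_Icc
  refine (memLp_two_iff_integrable_sq (h2.mono_set hsub).aestronglyMeasurable).2 ?_
  exact ((hg.pow 2).integrableOn_Icc).mono_set hsub

lemma memLp_two_Ioc (hκ : MemLp κ 2 (volume.restrict (Icc 0 1))) {t : ℝ}
    (ht : t ∈ Icc (0 : ℝ) 1) : MemLp κ 2 (volume.restrict (Ioc 0 t)) :=
  have hsub : Ioc 0 t ⊆ Icc (0 : ℝ) 1 := fun _ hs => ⟨hs.1.le, hs.2.trans ht.2⟩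
  hκ.mono_measure (Measure.restrict_mono hsub le_rfl)

lemma intervalIntegrable_mul (hκ : MemLp κ 2 (volume.restrict (Icc 0 1))) {g : ℝ → ℝ}
    (hg : ContinuousOn g (Icc 0 1)) {t : ℝ} (ht : t ∈ Icc (0 : ℝ) 1) :
    IntervalIntegrable (fun s => κ s * g s) volume 0 t := by
  rw [intervalIntegrable_iff_integrableOn_Ioc_of_le ht.1]
  exact (memLp_two_Ioc hκ ht).integrable_mul (memLp_two_of_continuousOn hg ht)

lemma sq_intervalIntegral_mul_le (hκ : MemLp κ 2 (volume.restrict (Icc 0 1)))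
    (hR : ∫ s in Icc (0 : ℝ) 1, κ s ^ 2 ≤ R) {g : ℝ → ℝ}
    (hg : ContinuousOn g (Icc 0 1)) {t : ℝ} (ht : t ∈ Icc (0 : ℝ) 1) :
    (∫ s in (0 : ℝ)..t, κ s * g s) ^ 2 ≤ R * ∫ s in (0 : ℝ)..t, g s ^ 2 := by
  rw [intervalIntegral.integral_of_le ht.1, intervalIntegral.integral_of_le ht.1]
  refine (sq_integral_mul_le (memLp_two_Ioc hκ ht) (memLp_two_of_continuousOn hg ht)).trans ?_
  refine mul_le_mul_of_nonneg_right ?_ (integral_nonneg fun _ => sq_nonneg _)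
  have hsub : Ioc 0 t ⊆ Icc (0 : ℝ) 1 := fun s hs => ⟨hs.1.le, hs.2.trans ht.2⟩
  exact le_trans (setIntegral_mono_set hκ.integrable_sq (ae_of_all _ fun _ => sq_nonneg _)
    (ae_of_all _ hsub)) hR

lemma nonneg_of_integral_sq_le (hR : ∫ s in Icc (0 : ℝ) 1, κ s ^ 2 ≤ R) : 0 ≤ R :=
  le_trans (integral_nonneg fun _ => sq_nonneg _) hR

/-- Squaring and Cauchy-Schwarz replace `κ` by the constant `R`, which reduces the problem to
Grönwall for `g²` with a constant coefficient. -/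
lemma sq_le_add_integral_sq (hκ : MemLp κ 2 (volume.restrict (Icc 0 1)))
    (hR : ∫ s in Icc (0 : ℝ) 1, κ s ^ 2 ≤ R) {g r : ℝ → ℝ}
    (hg : ContinuousOn g (Icc 0 1)) (hg0 : ∀ t ∈ Icc (0 : ℝ) 1, 0 ≤ g t)
    {t : ℝ} (ht : t ∈ Icc (0 : ℝ) 1) (h : g t ≤ r t + ∫ s in (0 : ℝ)..t, κ s * g s) :
    g t ^ 2 ≤ 2 * r t ^ 2 + 2 * R * ∫ s in (0 : ℝ)..t, g s ^ 2 := by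
  have h1 := sq_intervalIntegral_mul_le hκ hR hg ht
  have h2 : g t ^ 2 ≤ (r t + ∫ s in (0 : ℝ)..t, κ s * g s) ^ 2 :=
    pow_le_pow_left₀ (hg0 t ht) h 2
  nlinarith [sq_nonneg (r t - ∫ s in (0 : ℝ)..t, κ s * g s)]

/-- Grönwall's inequality with a coefficient that is only square integrable in time. -/
lemma gronwall_sq (hκ : MemLp κ 2 (volume.restrict (Icc 0 1)))
    (hR : ∫ s in Icc (0 : ℝ) 1, κ s ^ 2 ≤ R) {g : ℝ → ℝ} {a : ℝ} (ha : 0 ≤ a)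
    (hg : ContinuousOn g (Icc 0 1)) (hg0 : ∀ t ∈ Icc (0 : ℝ) 1, 0 ≤ g t)
    (h : ∀ t ∈ Icc (0 : ℝ) 1, g t ≤ a + ∫ s in (0 : ℝ)..t, κ s * g s) :
    ∀ t ∈ Icc (0 : ℝ) 1, g t ≤ 2 * Real.exp R * a := by
  have hR0 := nonneg_of_integral_sq_le hR
  intro t ht
  have h1 := le_mul_exp_of_le_add_integral (w := fun s => g s ^ 2) (A := 2 * a ^ 2) (B := 2 * R)
    (hg.pow 2) (by positivity)
    (fun s hs => sq_le_add_integral_sq (r := fun _ => a) hκ hR hg hg0 hs (h s hs)) t ht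
  have h2 : Real.exp (2 * R * t) ≤ Real.exp R ^ 2 := by
    rw [← Real.exp_nat_mul]
    apply Real.exp_le_exp.2
    have := mul_le_mul_of_nonneg_left ht.2 hR0
    push_cast
    linarith
  -- The squared bound has the factor 2, and the stated constant squares to 4; this avoids a square
  -- root.
  refine abs_le_of_sq_le_sq' ?_ (by positivity) |>.2
  have : g t ^ 2 ≤ 2 * a ^ 2 * Real.exp R ^ 2 :=
    h1.trans (mul_le_mul_of_nonneg_left h2 (by positivity))
  nlinarith [mul_nonneg (sq_nonneg a) (sq_nonneg (Real.exp R))]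

/-- A version of Grönwall's inequality that controls the solution by the `L²` norm of the
inhomogeneity. -/
lemma gronwall_sq_integral (hκ : MemLp κ 2 (volume.restrict (Icc 0 1)))
    (hR : ∫ s in Icc (0 : ℝ) 1, κ s ^ 2 ≤ R) {g r : ℝ → ℝ}
    (hg : ContinuousOn g (Icc 0 1)) (hg0 : ∀ t ∈ Icc (0 : ℝ) 1, 0 ≤ g t)
    (hr : ContinuousOn r (Icc 0 1))
    (h : ∀ t ∈ Icc (0 : ℝ) 1, g t ≤ r t + ∫ s in (0 : ℝ)..t, κ s * g s) :
    g 1 ^ 2 ≤ 2 * r 1 ^ 2 + 2 * R * Real.exp (2 * R) * ∫ s in (0 : ℝ)..1, 2 * r s ^ 2 := by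
  have hR0 := nonneg_of_integral_sq_le hR
  have hpt := fun t (ht : t ∈ Icc (0 : ℝ) 1) =>
    sq_le_add_integral_sq (r := r) hκ hR hg hg0 ht (h t ht)
  -- As `r` varies with time, Grönwall is applied to the primitive of `g²`: its inhomogeneity is
  -- bounded by the full integral of `2 r²`, a constant.
  set U : ℝ → ℝ := fun t => ∫ s in (0 : ℝ)..t, g s ^ 2 with hU
  have hUc : ContinuousOn U (Icc 0 1) := by
    have := intervalIntegral.continuousOn_primitive_interval (a := 0) (b := 1)
      (f := fun s => g s ^ 2) (μ := volume)
      (by rw [uIcc_of_le zero_le_one]; exact (hg.pow 2).integrableOn_Icc)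
    rwa [uIcc_of_le zero_le_one] at this
  have hrc : ContinuousOn (fun s => 2 * r s ^ 2) (Icc 0 1) := continuousOn_const.mul (hr.pow 2)
  have hii : ∀ {f : ℝ → ℝ} {t : ℝ}, ContinuousOn f (Icc 0 1) → t ∈ Icc (0 : ℝ) 1 →
      IntervalIntegrable f volume 0 t := fun {f t} hf ht =>
    (hf.mono (by rw [uIcc_of_le ht.1]; exact Icc_subset_Icc_right ht.2)).intervalIntegrable
  have hUle : ∀ t ∈ Icc (0 : ℝ) 1,
      U t ≤ (∫ s in (0 : ℝ)..1, 2 * r s ^ 2) + (2 * R) * ∫ s in (0 : ℝ)..t, U s := by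
    intro t ht
    have h1 : U t ≤ ∫ s in (0 : ℝ)..t, (2 * r s ^ 2 + 2 * R * U s) :=
      intervalIntegral.integral_mono_on ht.1 (hii (hg.pow 2) ht)
        ((hii hrc ht).add ((hii hUc ht).const_mul _))
        (fun s hs => hpt s ⟨hs.1, hs.2.trans ht.2⟩)
    rw [intervalIntegral.integral_add (hii hrc ht) ((hii hUc ht).const_mul _),
      intervalIntegral.integral_const_mul (2 * R)] at h1
    refine h1.trans (add_le_add_left ?_ _)
    exact intervalIntegral.integral_mono_interval le_rfl ht.1 ht.2
      (ae_of_all _ fun s => by positivity) (hii hrc ⟨zero_le_one, le_rfl⟩)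
  have hU1 := le_mul_exp_of_le_add_integral hUc (by positivity : 0 ≤ 2 * R) hUle 1
    ⟨zero_le_one, le_rfl⟩
  rw [mul_one] at hU1
  have := hpt 1 ⟨zero_le_one, le_rfl⟩
  have h3 := mul_le_mul_of_nonneg_left hU1 (by positivity : 0 ≤ 2 * R)
  linarith

/-! ### Carathéodory differential equations -/

variable {E : Type*} [NormedAddCommGroup E] [NormedSpace ℝ E]

/-- The primitive of an integrable function is continuous. -/
lemma continuousOn_primitive_unitInterval {f : ℝ → E} (hf : IntegrableOn f (Icc 0 1)) :
    ContinuousOn (fun t => ∫ s in (0 : ℝ)..t, f s) (Icc 0 1) := by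
  have := intervalIntegral.continuousOn_primitive_interval (a := 0) (b := 1)
    (f := f) (μ := volume) (by rwa [uIcc_of_le zero_le_one])
  rwa [uIcc_of_le zero_le_one] at this

lemma intervalIntegrable_of_integrableOn_Icc {E : Type*} [NormedAddCommGroup E] {f : ℝ → E} (hf : IntegrableOn f (Icc 0 1)) {t : ℝ}
    (ht : t ∈ Icc (0 : ℝ) 1) : IntervalIntegrable f volume 0 t := by
  rw [intervalIntegrable_iff_integrableOn_Ioc_of_le ht.1]
  exact hf.mono_set fun s hs => ⟨hs.1.le, hs.2.trans ht.2⟩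

/-- The Picard operator of the differential equation `y' = f(s, y)`, `y(0) = x`. -/
def picardMap (f : ℝ → E → E)
    (hf : ∀ y : ℝ → E, Continuous y → IntegrableOn (fun s => f s (y s)) (Icc 0 1)) (x : E)
    (a : C(Icc (0 : ℝ) 1, E)) : C(Icc (0 : ℝ) 1, E) where
  toFun t := x + ∫ s in (0 : ℝ)..t, f s (IccExtend zero_le_one a s)
  continuous_toFun := continuous_const.add
    (continuousOn_iff_continuous_domRestrict.1
      (continuousOn_primitive_unitInterval (hf _ a.continuous.Icc_extend')))

lemma sq_norm_picardMap_sub_le {f : ℝ → E → E}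
    (hf : ∀ y : ℝ → E, Continuous y → IntegrableOn (fun s => f s (y s)) (Icc 0 1)) (x : E)
    (hκ : MemLp κ 2 (volume.restrict (Icc 0 1)))
    (hR : ∫ s in Icc (0 : ℝ) 1, κ s ^ 2 ≤ R)
    (hL : ∀ s y z, ‖f s y - f s z‖ ≤ κ s * ‖y - z‖) (a b : C(Icc (0 : ℝ) 1, E))
    (t : Icc (0 : ℝ) 1) :
    ‖picardMap f hf x a t - picardMap f hf x b t‖ ^ 2 ≤ R * ∫ s in (0 : ℝ)..t,
      ‖IccExtend zero_le_one a s - IccExtend zero_le_one b s‖ ^ 2 := by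
  have hc : Continuous fun s => ‖IccExtend zero_le_one a s - IccExtend zero_le_one b s‖ :=
    (a.continuous.Icc_extend'.sub b.continuous.Icc_extend').norm
  refine le_trans ?_ (sq_intervalIntegral_mul_le hκ hR hc.continuousOn t.2)
  refine pow_le_pow_left₀ (norm_nonneg _) ?_ 2
  have ha := intervalIntegrable_of_integrableOn_Icc 
    (hf (IccExtend zero_le_one a) a.continuous.Icc_extend') t.2
  have hb := intervalIntegrable_of_integrableOn_Icc 
    (hf (IccExtend zero_le_one b) b.continuous.Icc_extend') t.2
  have : picardMap f hf x a t - picardMap f hf x b t = ∫ s in (0 : ℝ)..t,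
      (f s (IccExtend zero_le_one a s) - f s (IccExtend zero_le_one b s)) := by
    rw [intervalIntegral.integral_sub ha hb]
    simp [picardMap]
  rw [this]
  exact intervalIntegral.norm_integral_le_of_norm_le t.2.1 (ae_of_all _ fun s _ => hL s _ _)
    (intervalIntegrable_mul hκ hc.continuousOn t.2)

/-- Each iteration integrates a power of `t`, which produces the factorial. Thus a high iterate
contracts even when `R` is large and the Picard map itself does not. -/
lemma sq_norm_picardMap_iterate_sub_le {f : ℝ → E → E}
    (hf : ∀ y : ℝ → E, Continuous y → IntegrableOn (fun s => f s (y s)) (Icc 0 1)) (x : E)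
    (hκ : MemLp κ 2 (volume.restrict (Icc 0 1)))
    (hR : ∫ s in Icc (0 : ℝ) 1, κ s ^ 2 ≤ R)
    (hL : ∀ s y z, ‖f s y - f s z‖ ≤ κ s * ‖y - z‖) (a b : C(Icc (0 : ℝ) 1, E))
    (N : ℕ) (t : Icc (0 : ℝ) 1) :
    ‖(picardMap f hf x)^[N] a t - (picardMap f hf x)^[N] b t‖ ^ 2
      ≤ R ^ N * (t : ℝ) ^ N / N.factorial * dist a b ^ 2 := by
  have hR0 := nonneg_of_integral_sq_le hR
  induction N generalizing t with
  | zero =>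
    simp only [Function.iterate_zero, id, pow_zero, mul_one, Nat.factorial_zero, Nat.cast_one,
      div_one, one_mul]
    rw [← dist_eq_norm]
    exact pow_le_pow_left₀ dist_nonneg (ContinuousMap.dist_apply_le_dist t) 2
  | succ N ih =>
    rw [Function.iterate_succ_apply', Function.iterate_succ_apply']
    set a' := (picardMap f hf x)^[N] a
    set b' := (picardMap f hf x)^[N] b
    refine (sq_norm_picardMap_sub_le hf x hκ hR hL a' b' t).trans ?_
    have h1 : ∫ s in (0 : ℝ)..t,
        ‖IccExtend zero_le_one a' s - IccExtend zero_le_one b' s‖ ^ 2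
        ≤ ∫ s in (0 : ℝ)..t, (R ^ N / N.factorial * dist a b ^ 2) * s ^ N := by
      refine intervalIntegral.integral_mono_on t.2.1 ?_ ?_ ?_
      · exact ((a'.continuous.Icc_extend'.sub b'.continuous.Icc_extend').norm.pow 2
          ).intervalIntegrable _ _
      · exact (continuous_const.mul (continuous_pow N)).intervalIntegrable _ _
      · intro s hs
        have hs' : s ∈ Icc (0 : ℝ) 1 := ⟨hs.1, hs.2.trans t.2.2⟩
        rw [IccExtend_of_mem _ _ hs', IccExtend_of_mem _ _ hs']
        refine (ih ⟨s, hs'⟩).trans (le_of_eq ?_)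
        simp only
        ring
    rw [intervalIntegral.integral_const_mul, integral_pow] at h1
    refine (mul_le_mul_of_nonneg_left h1 hR0).trans (le_of_eq ?_)
    rw [Nat.factorial_succ]
    push_cast
    field_simp
    rw [zero_pow N.succ_ne_zero, sub_zero]
    ring

/-- Existence for the Carathéodory differential equation `y' = f(s, y)` on `[0,1]`, in integrated
form, if the Lipschitz constant of `f(s, ·)` is square integrable in time. -/
theorem exists_integral_solution [CompleteSpace E] {f : ℝ → E → E}
    (hf : ∀ y : ℝ → E, Continuous y → IntegrableOn (fun s => f s (y s)) (Icc 0 1))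
    (hκ : MemLp κ 2 (volume.restrict (Icc 0 1)))
    (hL : ∀ s y z, ‖f s y - f s z‖ ≤ κ s * ‖y - z‖) (x : E) :
    ∃ y : ℝ → E, Continuous y ∧
      ∀ t ∈ Icc (0 : ℝ) 1, y t = x + ∫ s in (0 : ℝ)..t, f s (y s) := by
  set R := ∫ s in Icc (0 : ℝ) 1, κ s ^ 2 with hR
  -- The estimate is for squared distances, so `1 / 4` yields the contraction constant `1 / 2`.
  obtain ⟨N, hN⟩ : ∃ N : ℕ, R ^ N / N.factorial < 1 / 4 :=
    ((FloorSemiring.tendsto_pow_div_factorial_atTop R).eventually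
      (gt_mem_nhds (by norm_num : (0 : ℝ) < 1 / 4))).exists
  have hcon : ContractingWith (1 / 2 : ℝ≥0) (picardMap f hf x)^[N] := by
    refine ⟨by rw [← NNReal.coe_lt_coe]; norm_num, LipschitzWith.of_dist_le_mul fun a b => ?_⟩
    refine (ContinuousMap.dist_le (by positivity)).2 fun t => ?_
    rw [dist_eq_norm]
    refine abs_le_of_sq_le_sq' ?_ (by positivity) |>.2
    refine (sq_norm_picardMap_iterate_sub_le hf x hκ hR.ge hL a b N t).trans ?_
    have h1 : R ^ N * (t : ℝ) ^ N / N.factorial ≤ 1 / 4 := by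
      refine le_trans ?_ hN.le
      have hR0 : 0 ≤ R := nonneg_of_integral_sq_le hR.ge
      gcongr
      exact mul_le_of_le_one_right (by positivity) (pow_le_one₀ t.2.1 t.2.2)
    refine (mul_le_mul_of_nonneg_right h1 (sq_nonneg _)).trans (le_of_eq ?_)
    push_cast
    ring
  set a := ContractingWith.fixedPoint _ hcon
  -- The unique fixed point of an iterate is fixed by the map itself.
  have ha : picardMap f hf x a = a := hcon.isFixedPt_fixedPoint_iterate
  refine ⟨IccExtend zero_le_one a, a.continuous.Icc_extend', fun t ht => ?_⟩
  rw [IccExtend_of_mem _ _ ht]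
  conv_lhs => rw [← ha]
  rfl

end

/-! ### Vector fields with bounded derivatives -/

section

variable {n : ℕ} {V : Type*} [NormedAddCommGroup V] [InnerProductSpace ℝ V]
  [RKHS ℝ V (Eucl n) (Eucl n)]

/-- `c` bounds the norm of the embedding of `V` into `C²`. -/
structure C2Bound (n : ℕ) (V : Type*) [NormedAddCommGroup V] [InnerProductSpace ℝ V]
    [RKHS ℝ V (Eucl n) (Eucl n)] (c : ℝ) : Prop where
  nonneg : 0 ≤ c
  contDiff : ∀ w : V, ContDiff ℝ 2 (w : Eucl n → Eucl n)
  bound : ∀ w : V, ∀ k ≤ 2, ∀ x : Eucl n,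
    ‖iteratedFDeriv ℝ k (w : Eucl n → Eucl n) x‖ ≤ c * ‖w‖

lemma EmbedsInC02.exists_bound (h : EmbedsInC02 n V) : ∃ c, C2Bound n V c := by
  obtain ⟨h1, c, hc⟩ := h
  -- The embedding constant comes without a sign.
  refine ⟨|c|, abs_nonneg c, fun w => (h1 w).1, fun w k hk x => (hc w k hk x).trans ?_⟩
  exact mul_le_mul_of_nonneg_right (le_abs_self c) (norm_nonneg w)

namespace C2Bound

variable {c : ℝ} (hc : C2Bound n V c)

include hc

lemma norm_apply_le (w : V) (x : Eucl n) : ‖w x‖ ≤ c * ‖w‖ := by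
  simpa using hc.bound w 0 (by norm_num) x

lemma norm_fderiv_le (w : V) (x : Eucl n) : ‖fderiv ℝ w x‖ ≤ c * ‖w‖ := by
  simpa [norm_iteratedFDeriv_one] using hc.bound w 1 (by norm_num) x

lemma differentiable (w : V) : Differentiable ℝ w :=
  (hc.contDiff w).differentiable (by norm_num)

lemma differentiable_fderiv (w : V) : Differentiable ℝ (fderiv ℝ w) :=
  ((hc.contDiff w).fderiv_right (m := 1) (by norm_num)).differentiable (by norm_num)

lemma norm_apply_sub_le (w : V) (x y : Eucl n) : ‖w x - w y‖ ≤ c * ‖w‖ * ‖x - y‖ :=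
  convex_univ.norm_image_sub_le_of_norm_fderiv_le (fun z _ => hc.differentiable w z)
    (fun z _ => hc.norm_fderiv_le w z) (mem_univ y) (mem_univ x)

lemma norm_fderiv_sub_le (w : V) (x y : Eucl n) :
    ‖fderiv ℝ w x - fderiv ℝ w y‖ ≤ c * ‖w‖ * ‖x - y‖ := by
  refine convex_univ.norm_image_sub_le_of_norm_fderiv_le (𝕜 := ℝ)
    (fun z _ => hc.differentiable_fderiv w z) (fun z _ => ?_) (mem_univ y) (mem_univ x)
  rw [← norm_iteratedFDeriv_one, norm_iteratedFDeriv_fderiv]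
  exact hc.bound w 2 le_rfl z

/-- First order Taylor estimate. -/
lemma norm_apply_sub_sub_fderiv_le (w : V) (x y : Eucl n) :
    ‖w y - w x - fderiv ℝ w x (y - x)‖ ≤ c * ‖w‖ * ‖y - x‖ ^ 2 := by
  have := (convex_segment x y).norm_image_sub_le_of_norm_fderiv_le' (𝕜 := ℝ) (f := w)
    (φ := fderiv ℝ w x) (C := c * ‖w‖ * ‖y - x‖) (fun z _ => hc.differentiable w z)
    (fun z hz => ?_) (left_mem_segment ℝ x y) (right_mem_segment ℝ x y)
  · rw [pow_two, ← mul_assoc]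
    exact this
  · refine (hc.norm_fderiv_sub_le w z x).trans ?_
    have h0 := hc.nonneg
    have : ‖z - x‖ ≤ ‖y - x‖ := by
      rw [segment_eq_image'] at hz
      obtain ⟨θ, hθ, rfl⟩ := hz
      rw [add_sub_cancel_left, norm_smul, Real.norm_of_nonneg hθ.1]
      exact mul_le_of_le_one_left (norm_nonneg _) hθ.2
    gcongr

/-- Joint continuity makes `s ↦ v s (y s)` almost everywhere strongly measurable for a strongly
measurable `v` and a continuous curve `y`. -/
lemma continuous_eval : Continuous fun p : V × Eucl n => p.1 p.2 := by
  refine continuous_iff_continuousAt.2 fun p => ?_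
  rw [ContinuousAt, tendsto_iff_norm_sub_tendsto_zero]
  have hlim : Tendsto (fun q : V × Eucl n => c * ‖q.1 - p.1‖ + c * ‖p.1‖ * ‖q.2 - p.2‖)
      (𝓝 p) (𝓝 (c * ‖p.1 - p.1‖ + c * ‖p.1‖ * ‖p.2 - p.2‖)) := by
    apply Continuous.tendsto
    fun_prop
  simp only [sub_self, norm_zero, mul_zero, add_zero] at hlim
  refine squeeze_zero (fun _ => norm_nonneg _) (fun q => ?_) hlim
  have : q.1 q.2 - p.1 p.2 = (q.1 - p.1) q.2 + (p.1 q.2 - p.1 p.2) := by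
    rw [RKHS.coe_sub, Pi.sub_apply]; abel
  rw [this]
  exact (norm_add_le _ _).trans
    (add_le_add (hc.norm_apply_le _ _) (hc.norm_apply_sub_le _ _ _))

lemma continuous_fderiv : Continuous fun p : V × Eucl n => fderiv ℝ p.1 p.2 := by
  refine continuous_iff_continuousAt.2 fun p => ?_
  rw [ContinuousAt, tendsto_iff_norm_sub_tendsto_zero]
  have hlim : Tendsto (fun q : V × Eucl n => c * ‖q.1 - p.1‖ + c * ‖p.1‖ * ‖q.2 - p.2‖)
      (𝓝 p) (𝓝 (c * ‖p.1 - p.1‖ + c * ‖p.1‖ * ‖p.2 - p.2‖)) := by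
    apply Continuous.tendsto
    fun_prop
  simp only [sub_self, norm_zero, mul_zero, add_zero] at hlim
  refine squeeze_zero (fun _ => norm_nonneg _) (fun q => ?_) hlim
  have : fderiv ℝ q.1 q.2 - fderiv ℝ p.1 p.2
      = fderiv ℝ (q.1 - p.1 : V) q.2 + (fderiv ℝ p.1 q.2 - fderiv ℝ p.1 p.2) := by
    rw [RKHS.coe_sub, fderiv_sub (hc.differentiable _ _) (hc.differentiable _ _)]; abel
  rw [this]
  exact (norm_add_le _ _).trans
    (add_le_add (hc.norm_fderiv_le _ _) (hc.norm_fderiv_sub_le _ _ _))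

end C2Bound

/-! ### Trajectories of square integrable velocity fields -/

lemma integral_norm_sq_eq (v : Velocity V) :
    ∫ s in Icc (0 : ℝ) 1, ‖v s‖ ^ 2 = ‖v‖ ^ 2 := by
  rw [← real_inner_self_eq_norm_sq, L2.inner_def]
  simp only [real_inner_self_eq_norm_sq]

lemma memLp_mul_norm {V : Type*} [NormedAddCommGroup V] (c : ℝ) (v : Velocity V) :
    MemLp (fun s => c * ‖v s‖) 2 (volume.restrict (Icc (0 : ℝ) 1)) :=
  (Lp.memLp v).norm.const_mul c

/-- A bound `M` in place of `‖v‖` keeps the later constants uniform along a bounded sequence of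
velocities. -/
lemma integral_sq_mul_norm_le {c M : ℝ} {v : Velocity V} (hv : ‖v‖ ≤ M) :
    ∫ s in Icc (0 : ℝ) 1, (c * ‖v s‖) ^ 2 ≤ (c * M) ^ 2 := by
  simp only [mul_pow]
  rw [integral_const_mul, integral_norm_sq_eq]
  have := norm_nonneg v
  gcongr

lemma integrableOn_mul_norm {V : Type*} [NormedAddCommGroup V] (c : ℝ) (v : Velocity V) :
    IntegrableOn (fun s => c * ‖v s‖) (Icc (0 : ℝ) 1) :=
  (memLp_mul_norm c v).integrable (by norm_num)

lemma intervalIntegral_mul_norm_le {c M : ℝ} (hc : 0 ≤ c) {v : Velocity V} (hv : ‖v‖ ≤ M)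
    {t : ℝ} (ht : t ∈ Icc (0 : ℝ) 1) : ∫ s in (0 : ℝ)..t, c * ‖v s‖ ≤ c * M := by
  have hM : 0 ≤ M := (norm_nonneg v).trans hv
  -- Cauchy-Schwarz against the constant 1, on an interval of length at most 1.
  have h := sq_intervalIntegral_mul_le (memLp_mul_norm c v) (integral_sq_mul_norm_le hv)
    (g := fun _ => 1) continuousOn_const ht
  simp only [mul_one, one_pow, intervalIntegral.integral_const, sub_zero, smul_eq_mul] at h
  refine abs_le_of_sq_le_sq' (h.trans ?_) (by positivity) |>.2
  exact mul_le_of_le_one_right (sq_nonneg _) ht.2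

lemma aestronglyMeasurable_prod {V : Type*} [NormedAddCommGroup V] {v : Velocity V} {y : ℝ → Eucl n}
    (hy : ContinuousOn y (Icc 0 1)) :
    AEStronglyMeasurable (fun s => (v s, y s)) (volume.restrict (Icc (0 : ℝ) 1)) :=
  (Lp.aestronglyMeasurable v).prodMk (hy.aestronglyMeasurable measurableSet_Icc)

variable {c : ℝ}

lemma C2Bound.integrableOn_eval (hc : C2Bound n V c) (v : Velocity V) {y : ℝ → Eucl n}
    (hy : ContinuousOn y (Icc 0 1)) : IntegrableOn (fun s => v s (y s)) (Icc 0 1) :=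
  (integrableOn_mul_norm c v).mono'
    (hc.continuous_eval.comp_aestronglyMeasurable (aestronglyMeasurable_prod hy))
    (ae_of_all _ fun s => hc.norm_apply_le (v s) (y s))

lemma C2Bound.integrableOn_fderiv_comp (hc : C2Bound n V c) (v : Velocity V) {y : ℝ → Eucl n}
    (hy : ContinuousOn y (Icc 0 1)) {A : ℝ → Eucl n →L[ℝ] Eucl n} (hA : Continuous A) :
    IntegrableOn (fun s => (fderiv ℝ (v s) (y s)).comp (A s)) (Icc 0 1) := by
  obtain ⟨C, hC⟩ := (isCompact_Icc (a := (0 : ℝ)) (b := 1)).exists_bound_of_continuousOn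
    hA.continuousOn
  refine ((integrableOn_mul_norm c v).mul_const C).mono' ?_ ?_
  · have h1 : AEStronglyMeasurable (fun s => fderiv ℝ (v s) (y s))
        (volume.restrict (Icc (0 : ℝ) 1)) :=
      hc.continuous_fderiv.comp_aestronglyMeasurable (aestronglyMeasurable_prod hy)
    have h2 : Continuous fun p : (Eucl n →L[ℝ] Eucl n) × (Eucl n →L[ℝ] Eucl n) =>
        p.1.comp p.2 := by fun_prop
    exact h2.comp_aestronglyMeasurable (h1.prodMk hA.aestronglyMeasurable)
  · refine (ae_restrict_iff' measurableSet_Icc).2 (ae_of_all _ fun s hs => ?_)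
    refine (ContinuousLinearMap.opNorm_comp_le _ _).trans ?_
    exact mul_le_mul (hc.norm_fderiv_le _ _) (hC s hs) (norm_nonneg _)
      (mul_nonneg hc.nonneg (norm_nonneg _))

/-- `y` is a trajectory of `v` on `[0,1]` that starts at `x`. -/
structure IsTrajectory (v : Velocity V) (x : Eucl n) (y : ℝ → Eucl n) : Prop where
  continuousOn : ContinuousOn y (Icc 0 1)
  eq : ∀ t ∈ Icc (0 : ℝ) 1, y t = x + ∫ s in (0 : ℝ)..t, (v s : V) (y s)

lemma IsFlow.isTrajectory {v : Velocity V} {φ : ℝ → Eucl n → Eucl n} (h : IsFlow v φ)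
    (x : Eucl n) : IsTrajectory v x (fun t => φ t x) where
  continuousOn := by
    have hi : IntegrableOn (fun s => (v s : V) (φ s x)) (Icc 0 1) := by
      rw [integrableOn_Icc_iff_integrableOn_Ioc]
      exact (intervalIntegrable_iff_integrableOn_Ioc_of_le zero_le_one).1 (h x).1
    exact (continuousOn_const.add (continuousOn_primitive_unitInterval hi)).congr (h x).2
  eq := (h x).2

lemma C2Bound.exists_isTrajectory (hc : C2Bound n V c) (v : Velocity V) (x : Eucl n) :
    ∃ y, IsTrajectory v x y := by
  obtain ⟨y, hy, h⟩ := exists_integral_solution (f := fun s z => (v s : V) z)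
    (fun y hy => hc.integrableOn_eval v hy.continuousOn) (memLp_mul_norm c v)
    (fun s y z => hc.norm_apply_sub_le (v s) y z) x
  exact ⟨y, hy.continuousOn, h⟩

lemma C2Bound.exists_isFlow (hc : C2Bound n V c) (v : Velocity V) :
    ∃ φ : ℝ → Eucl n → Eucl n, IsFlow v φ := by
  choose y hy using hc.exists_isTrajectory v
  exact ⟨fun t x => y x t, fun x => ⟨intervalIntegrable_of_integrableOn_Icc
    (hc.integrableOn_eval v (hy x).continuousOn) ⟨zero_le_one, le_rfl⟩, (hy x).eq⟩⟩

lemma C2Bound.isFlow_flow (hc : C2Bound n V c) (v : Velocity V) :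
    IsFlow v (flow v : ℝ → Eucl n → Eucl n) := by
  have h := hc.exists_isFlow v
  rw [flow, dif_pos h]
  exact h.choose_spec

/-- Trajectories depend in a Lipschitz way on the starting point. -/
lemma C2Bound.norm_trajectory_sub_le (hc : C2Bound n V c) {M : ℝ} {v : Velocity V}
    (hv : ‖v‖ ≤ M) {x x' : Eucl n} {y y' : ℝ → Eucl n} (hy : IsTrajectory v x y)
    (hy' : IsTrajectory v x' y') :
    ∀ t ∈ Icc (0 : ℝ) 1, ‖y t - y' t‖ ≤ 2 * Real.exp ((c * M) ^ 2) * ‖x - x'‖ := by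
  have hcont := (hy.continuousOn.sub hy'.continuousOn).norm
  refine gronwall_sq (memLp_mul_norm c v) (integral_sq_mul_norm_le hv) (norm_nonneg _)
    hcont (fun _ _ => norm_nonneg _) fun t ht => ?_
  have h1 := intervalIntegrable_of_integrableOn_Icc (hc.integrableOn_eval v hy.continuousOn) ht
  have h2 := intervalIntegrable_of_integrableOn_Icc (hc.integrableOn_eval v hy'.continuousOn) ht
  have : y t - y' t = (x - x') + ∫ s in (0 : ℝ)..t, (v s (y s) - v s (y' s)) := by
    rw [intervalIntegral.integral_sub h1 h2, hy.eq t ht, hy'.eq t ht]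
    abel
  rw [this]
  refine (norm_add_le _ _).trans (add_le_add le_rfl ?_)
  exact intervalIntegral.norm_integral_le_of_norm_le ht.1
    (ae_of_all _ fun s _ => hc.norm_apply_sub_le _ _ _)
    (intervalIntegrable_mul (memLp_mul_norm c v) hcont ht)

lemma C2Bound.isFlow_unique (hc : C2Bound n V c) {v : Velocity V}
    {φ ψ : ℝ → Eucl n → Eucl n} (hφ : IsFlow v φ) (hψ : IsFlow v ψ) :
    ∀ t ∈ Icc (0 : ℝ) 1, φ t = ψ t := by
  intro t ht
  funext x
  have := hc.norm_trajectory_sub_le le_rfl (hφ.isTrajectory x) (hψ.isTrajectory x) t ht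
  rw [sub_self, norm_zero, mul_zero] at this
  exact sub_eq_zero.1 (norm_le_zero_iff.1 this)

/-- The flow has a first order Taylor expansion, with a constant that depends only on the norm of
the velocity field. -/
lemma C2Bound.exists_taylor_flow (hc : C2Bound n V c) {M : ℝ} {v : Velocity V} (hv : ‖v‖ ≤ M)
    {φ : ℝ → Eucl n → Eucl n} (hφ : IsFlow v φ) (x : Eucl n) :
    ∃ A : Eucl n →L[ℝ] Eucl n, ∀ h : Eucl n, ‖φ 1 (x + h) - φ 1 x - A h‖ ≤
      2 * Real.exp ((c * M) ^ 2) * (c * M * (2 * Real.exp ((c * M) ^ 2)) ^ 2) * ‖h‖ ^ 2 := by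
  set L := 2 * Real.exp ((c * M) ^ 2) with hL
  have hM : 0 ≤ M := (norm_nonneg v).trans hv
  have hc0 := hc.nonneg
  have hφx := hφ.isTrajectory x
  -- `A` solves the equation linearized along the trajectory, `A' = Dv(φ) A` with `A 0 = id`; `A 1`
  -- is the candidate for the differential of the flow.
  obtain ⟨A, hAc, hA⟩ := exists_integral_solution
    (f := fun s B => (fderiv ℝ (v s) (φ s x)).comp B)
    (fun B hB => hc.integrableOn_fderiv_comp v hφx.continuousOn hB) (memLp_mul_norm c v)
    (fun s B B' => by
      rw [← ContinuousLinearMap.comp_sub]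
      refine (ContinuousLinearMap.opNorm_comp_le _ _).trans ?_
      exact mul_le_mul_of_nonneg_right (hc.norm_fderiv_le _ _) (norm_nonneg _))
    (ContinuousLinearMap.id ℝ (Eucl n))
  refine ⟨A 1, fun h => ?_⟩
  have hφh := hφ.isTrajectory (x + h)
  have hAh : ContinuousOn (fun t => A t h) (Icc 0 1) := by fun_prop
  have hcont : ContinuousOn (fun s => ‖φ s (x + h) - φ s x - A s h‖) (Icc 0 1) :=
    ((hφh.continuousOn.sub hφx.continuousOn).sub hAh).norm
  have key := gronwall_sq (memLp_mul_norm c v) (integral_sq_mul_norm_le hv)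
    -- The two trajectories stay within `L * ‖h‖` of each other; this bounds the time integral of
    -- the quadratic Taylor remainder of `v s` between them.
    (a := c * M * (L * ‖h‖) ^ 2) (by positivity) hcont (fun _ _ => norm_nonneg _)
    (fun t ht => ?_) 1 ⟨zero_le_one, le_rfl⟩
  · refine key.trans (le_of_eq ?_)
    rw [← hL]; ring
  have h1 := intervalIntegrable_of_integrableOn_Icc (hc.integrableOn_eval v hφh.continuousOn) ht
  have h2 := intervalIntegrable_of_integrableOn_Icc (hc.integrableOn_eval v hφx.continuousOn) ht
  have h3 := intervalIntegrable_of_integrableOn_Icc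
    (hc.integrableOn_fderiv_comp v hφx.continuousOn hAc) ht
  have h3' : IntervalIntegrable (fun s => fderiv ℝ (v s) (φ s x) (A s h)) volume 0 t :=
    ⟨h3.1.apply_continuousLinearMap h, h3.2.apply_continuousLinearMap h⟩
  have hAt : A t h = h + ∫ s in (0 : ℝ)..t, fderiv ℝ (v s) (φ s x) (A s h) := by
    conv_lhs => rw [hA t ht]
    rw [add_apply, ContinuousLinearMap.intervalIntegral_apply h3]
    rfl
  have heq : φ t (x + h) - φ t x - A t h = ∫ s in (0 : ℝ)..t,
      (v s (φ s (x + h)) - v s (φ s x) - fderiv ℝ (v s) (φ s x) (A s h)) := by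
    rw [intervalIntegral.integral_sub (h1.sub h2) h3', intervalIntegral.integral_sub h1 h2,
      hAt, hφh.eq t ht, hφx.eq t ht]
    abel
  have hI1 : IntervalIntegrable (fun s => c * ‖v s‖ * (L * ‖h‖) ^ 2) volume 0 t :=
    intervalIntegrable_mul (memLp_mul_norm c v) continuousOn_const ht
  have hI2 := intervalIntegrable_mul (memLp_mul_norm c v) hcont ht
  rw [heq]
  calc _ ≤ ∫ s in (0 : ℝ)..t, (c * ‖v s‖ * (L * ‖h‖) ^ 2
          + c * ‖v s‖ * ‖φ s (x + h) - φ s x - A s h‖) := by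
        refine intervalIntegral.norm_integral_le_of_norm_le ht.1 ?_ (hI1.add hI2)
        refine ae_of_all _ fun s hs => ?_
        have hs' : s ∈ Icc (0 : ℝ) 1 := ⟨hs.1.le, hs.2.trans ht.2⟩
        -- The integrand splits into the Taylor remainder of `v s` and a term linear in the flow's
        -- own remainder, which Grönwall absorbs.
        have e : v s (φ s (x + h)) - v s (φ s x) - fderiv ℝ (v s) (φ s x) (A s h)
            = (v s (φ s (x + h)) - v s (φ s x)
                - fderiv ℝ (v s) (φ s x) (φ s (x + h) - φ s x))
              + fderiv ℝ (v s) (φ s x) (φ s (x + h) - φ s x - A s h) := by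
          simp only [map_sub]; abel
        rw [e]
        refine (norm_add_le _ _).trans (add_le_add ?_ ?_)
        · refine (hc.norm_apply_sub_sub_fderiv_le _ _ _).trans ?_
          have := hc.norm_trajectory_sub_le hv hφh hφx s hs'
          rw [add_sub_cancel_left] at this
          gcongr
        · exact (ContinuousLinearMap.le_opNorm _ _).trans
            (mul_le_mul_of_nonneg_right (hc.norm_fderiv_le _ _) (norm_nonneg _))
    _ = (∫ s in (0 : ℝ)..t, c * ‖v s‖) * (L * ‖h‖) ^ 2
          + ∫ s in (0 : ℝ)..t, c * ‖v s‖ * ‖φ s (x + h) - φ s x - A s h‖ := by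
        rw [intervalIntegral.integral_add hI1 hI2, intervalIntegral.integral_mul_const]
    _ ≤ _ := by
        have := intervalIntegral_mul_norm_le hc0 hv ht
        gcongr

end

/-! ### Weak compactness and weak continuity of the flow -/

/-- A bounded sequence in a Hilbert space has a weakly convergent subsequence. -/
theorem exists_weakly_convergent_subseq {H : Type*} [NormedAddCommGroup H]
    [InnerProductSpace ℝ H] [CompleteSpace H] (u : ℕ → H) {M : ℝ} (hu : ∀ k, ‖u k‖ ≤ M) :
    ∃ (v : H) (σ : ℕ → ℕ), StrictMono σ ∧
      ∀ ℓ : H →L[ℝ] ℝ, Tendsto (fun k => ℓ (u (σ k))) atTop (𝓝 (ℓ v)) := by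
  -- The closed span of the sequence is separable, so closed balls of its dual are weak-*
  -- sequentially compact; Riesz carries this back to the space.
  set S : Submodule ℝ H := (Submodule.span ℝ (range u)).topologicalClosure with hS
  have : CompleteSpace S :=
    (Submodule.isClosed_topologicalClosure _).completeSpace_coe
  have hsep : TopologicalSpace.IsSeparable (S : Set H) :=
    ((countable_range u).isSeparable.span (R := ℝ)).closure
  have : TopologicalSpace.SeparableSpace S := hsep.separableSpace
  have hmem : ∀ k, u k ∈ S := fun k =>
    Submodule.le_topologicalClosure _ (Submodule.subset_span (mem_range_self k))
  set f : ℕ → WeakDual ℝ S := fun k =>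
    StrongDual.toWeakDual (InnerProductSpace.toDual ℝ S ⟨u k, hmem k⟩) with hf
  have hball := WeakDual.isSeqCompact_closedBall ℝ S (0 : StrongDual ℝ S) M
  obtain ⟨g, -, σ, hσ, hlim⟩ := hball (x := f) fun k => by
    simp only [hf, mem_preimage, mem_closedBall_zero_iff]
    change ‖InnerProductSpace.toDual ℝ S ⟨u k, hmem k⟩‖ ≤ M
    rw [LinearIsometryEquiv.norm_map]
    exact hu k
  refine ⟨((InnerProductSpace.toDual ℝ S).symm (WeakDual.toStrongDual g) : S), σ, hσ, fun ℓ => ?_⟩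
  set r : S := (InnerProductSpace.toDual ℝ S).symm (ℓ.comp S.subtypeL) with hr
  have hℓ : ∀ y : S, ℓ y = inner ℝ y r := fun y => by
    rw [real_inner_comm, hr, InnerProductSpace.toDual_symm_apply]
    rfl
  have h1 := ((WeakDual.eval_continuous r).tendsto g).comp hlim
  rw [hℓ, InnerProductSpace.toDual_symm_apply]
  refine h1.congr fun k => ?_
  exact (hℓ ⟨u (σ k), hmem _⟩).symm

section

variable {n : ℕ} {V : Type*} [NormedAddCommGroup V] [InnerProductSpace ℝ V]
  [RKHS ℝ V (Eucl n) (Eucl n)] {c : ℝ}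

lemma C2Bound.norm_integral_eval_le (hc : C2Bound n V c) (v : Velocity V) (y : ℝ → Eucl n)
    {t : ℝ} (ht : t ∈ Icc (0 : ℝ) 1) : ‖∫ s in (0 : ℝ)..t, v s (y s)‖ ≤ c * ‖v‖ :=
  (intervalIntegral.norm_integral_le_of_norm_le ht.1
    (ae_of_all _ fun _ _ => hc.norm_apply_le _ _)
    (intervalIntegrable_of_integrableOn_Icc (integrableOn_mul_norm c v) ht)).trans
    (intervalIntegral_mul_norm_le hc.nonneg le_rfl ht)

/-- Integration of the velocity along a curve is a continuous linear functional of the velocity. -/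
lemma C2Bound.exists_integral_eval_clm (hc : C2Bound n V c) {y : ℝ → Eucl n}
    (hy : ContinuousOn y (Icc 0 1)) {t : ℝ} (ht : t ∈ Icc (0 : ℝ) 1) :
    ∃ ℓ : Velocity V →L[ℝ] Eucl n, ∀ v, ℓ v = ∫ s in (0 : ℝ)..t, v s (y s) := by
  have hsub : Ioc 0 t ⊆ Icc (0 : ℝ) 1 := fun s hs => ⟨hs.1.le, hs.2.trans ht.2⟩
  have hi := fun v : Velocity V =>
    intervalIntegrable_of_integrableOn_Icc (hc.integrableOn_eval v hy) ht
  have hae : ∀ {p : ℝ → Prop}, (∀ᵐ s ∂volume.restrict (Icc (0 : ℝ) 1), p s) →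
      ∀ᵐ s ∂volume.restrict (Ioc 0 t), p s := fun h => ae_restrict_of_ae_restrict_of_subset hsub h
  refine ⟨LinearMap.mkContinuous
    { toFun := fun v => ∫ s in (0 : ℝ)..t, v s (y s)
      map_add' := fun v w => ?_
      map_smul' := fun a v => ?_ } c fun v => hc.norm_integral_eval_le v y ht, fun v => rfl⟩
  · rw [← intervalIntegral.integral_add (hi v) (hi w), intervalIntegral.integral_of_le ht.1,
      intervalIntegral.integral_of_le ht.1]
    refine integral_congr_ae ?_
    filter_upwards [hae (Lp.coeFn_add v w)] with s hs
    rw [hs, Pi.add_apply, RKHS.coe_add, Pi.add_apply]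
  · rw [RingHom.id_apply, ← intervalIntegral.integral_smul, intervalIntegral.integral_of_le ht.1,
      intervalIntegral.integral_of_le ht.1]
    refine integral_congr_ae ?_
    filter_upwards [hae (Lp.coeFn_smul a v)] with s hs
    rw [hs, Pi.smul_apply, RKHS.coe_smul, Pi.smul_apply]

/-- The end point of the flow depends continuously on the velocity field, for the weak topology. -/
lemma C2Bound.tendsto_flow (hc : C2Bound n V c) {M : ℝ} {u : ℕ → Velocity V} {v : Velocity V}
    (hu : ∀ k, ‖u k‖ ≤ M)
    (hlim : ∀ ℓ : Velocity V →L[ℝ] ℝ, Tendsto (fun k => ℓ (u k)) atTop (𝓝 (ℓ v)))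
    (x : Eucl n) :
    Tendsto (fun k => flow (u k) 1 x) atTop (𝓝 (flow v 1 x)) := by
  have h1mem : (1 : ℝ) ∈ Icc (0 : ℝ) 1 := ⟨zero_le_one, le_rfl⟩
  have hy := (hc.isFlow_flow v).isTrajectory x
  have hyk := fun k => (hc.isFlow_flow (u k)).isTrajectory x
  set y : ℝ → Eucl n := fun t => flow v t x with hydef
  -- Both velocities are integrated along the same limit trajectory. The first integral is thus
  -- linear in `u k`, and weak convergence sends `r k t` to 0 for each `t`.
  set r : ℕ → ℝ → ℝ := fun k t =>
    ‖(∫ s in (0 : ℝ)..t, u k s (y s)) - ∫ s in (0 : ℝ)..t, v s (y s)‖ with hr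
  have hrlim : ∀ t ∈ Icc (0 : ℝ) 1, Tendsto (fun k => r k t) atTop (𝓝 0) := by
    intro t ht
    obtain ⟨ℓ, hℓ⟩ := hc.exists_integral_eval_clm hy.continuousOn ht
    refine tendsto_iff_norm_sub_tendsto_zero.1 ?_
    simp only [← hℓ]
    have h2 : Tendsto (fun k => WithLp.ofLp (ℓ (u k))) atTop (𝓝 (WithLp.ofLp (ℓ v))) :=
      tendsto_pi_nhds.2 fun i => hlim ((EuclideanSpace.proj i).comp ℓ)
    exact ((PiLp.continuous_toLp 2 _).tendsto _).comp h2
  have hrbound : ∀ k, ∀ t ∈ Icc (0 : ℝ) 1, r k t ≤ c * M + c * ‖v‖ := fun k t ht =>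
    (norm_sub_le _ _).trans (add_le_add ((hc.norm_integral_eval_le (u k) y ht).trans
      (mul_le_mul_of_nonneg_left (hu k) hc.nonneg)) (hc.norm_integral_eval_le v y ht))
  have hrc : ∀ k, ContinuousOn (r k) (Icc 0 1) := fun k =>
    ((continuousOn_primitive_unitInterval (hc.integrableOn_eval (u k) hy.continuousOn)).sub
      (continuousOn_primitive_unitInterval (hc.integrableOn_eval v hy.continuousOn))).norm
  have hest : ∀ k, ‖flow (u k) 1 x - y 1‖ ^ 2 ≤ 2 * r k 1 ^ 2
      + 2 * (c * M) ^ 2 * Real.exp (2 * (c * M) ^ 2) * ∫ s in (0 : ℝ)..1, 2 * r k s ^ 2 := by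
    intro k
    have hcont : ContinuousOn (fun t => ‖flow (u k) t x - y t‖) (Icc 0 1) :=
      ((hyk k).continuousOn.sub hy.continuousOn).norm
    refine gronwall_sq_integral (memLp_mul_norm c (u k)) (integral_sq_mul_norm_le (hu k))
      hcont (fun _ _ => norm_nonneg _) (hrc k) fun t ht => ?_
    have h1 := intervalIntegrable_of_integrableOn_Icc
      (hc.integrableOn_eval (u k) (hyk k).continuousOn) ht
    have h2 := intervalIntegrable_of_integrableOn_Icc
      (hc.integrableOn_eval (u k) hy.continuousOn) ht
    have heq : flow (u k) t x - y t
        = ((∫ s in (0 : ℝ)..t, u k s (y s)) - ∫ s in (0 : ℝ)..t, v s (y s))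
          + ∫ s in (0 : ℝ)..t, (u k s (flow (u k) s x) - u k s (y s)) := by
      rw [intervalIntegral.integral_sub h1 h2, (hyk k).eq t ht, hy.eq t ht]
      abel
    rw [heq]
    refine (norm_add_le _ _).trans (add_le_add le_rfl ?_)
    exact intervalIntegral.norm_integral_le_of_norm_le ht.1
      (ae_of_all _ fun s _ => hc.norm_apply_sub_le _ _ _)
      (intervalIntegrable_mul (memLp_mul_norm c (u k)) hcont ht)
  -- The convergence of `r k` is only pointwise in time; with the uniform bound `hrbound`, dominated
  -- convergence gives the `L²` smallness that Grönwall needs.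
  have hint : Tendsto (fun k => ∫ s in (0 : ℝ)..1, 2 * r k s ^ 2) atTop (𝓝 0) := by
    have := intervalIntegral.tendsto_integral_filter_of_dominated_convergence
      (μ := volume) (a := 0) (b := 1) (F := fun k s => 2 * r k s ^ 2) (f := fun _ => (0 : ℝ))
      (l := atTop) (fun _ => 2 * (c * M + c * ‖v‖) ^ 2) ?_ ?_ (by simp) ?_
    · simpa using this
    · refine Eventually.of_forall fun k => ?_
      rw [uIoc_of_le zero_le_one]
      exact ((continuousOn_const.mul ((hrc k).pow 2)).mono
        Ioc_subset_Icc_self).aestronglyMeasurable measurableSet_Ioc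
    · refine Eventually.of_forall fun k => ae_of_all _ fun s hs => ?_
      rw [uIoc_of_le zero_le_one] at hs
      rw [Real.norm_of_nonneg (by positivity)]
      have h0 : 0 ≤ r k s := norm_nonneg _
      have := hrbound k s (Ioc_subset_Icc_self hs)
      gcongr
    · refine ae_of_all _ fun s hs => ?_
      rw [uIoc_of_le zero_le_one] at hs
      simpa using ((hrlim s (Ioc_subset_Icc_self hs)).pow 2).const_mul 2
  rw [tendsto_iff_norm_sub_tendsto_zero]
  have hsq : Tendsto (fun k => ‖flow (u k) 1 x - y 1‖ ^ 2) atTop (𝓝 0) := by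
    refine squeeze_zero (fun _ => sq_nonneg _) hest ?_
    simpa using (((hrlim 1 h1mem).pow 2).const_mul 2).add
      (hint.const_mul (2 * (c * M) ^ 2 * Real.exp (2 * (c * M) ^ 2)))
  simpa using hsq.sqrt

/-! ### Convergence of the differentials -/

/-- A second order remainder estimate identifies the derivative. -/
lemma hasFDerivAt_of_norm_sub_le_sq {E F : Type*} [NormedAddCommGroup E] [NormedSpace ℝ E]
    [NormedAddCommGroup F] [NormedSpace ℝ F] {f : E → F} {x : E} {A : E →L[ℝ] F} {C : ℝ}
    (h : ∀ z, ‖f (x + z) - f x - A z‖ ≤ C * ‖z‖ ^ 2) : HasFDerivAt f A x := by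
  rw [hasFDerivAt_iff_isLittleO_nhds_zero]
  refine (Asymptotics.IsBigO.of_bound (g := fun z : E => ‖z‖ ^ 2) C
    (Eventually.of_forall fun z => ?_)).trans_isLittleO (Asymptotics.isLittleO_norm_pow_id one_lt_two)
  simpa using h z

/-- Pointwise convergence of maps with uniform second order remainder estimates implies the
convergence of their derivatives. -/
lemma tendsto_apply_of_norm_sub_le_sq {E F : Type*} [NormedAddCommGroup E] [NormedSpace ℝ E]
    [NormedAddCommGroup F] [NormedSpace ℝ F] {f : ℕ → E → F} {g : E → F} {x : E}
    {A : ℕ → E →L[ℝ] F} {B : E →L[ℝ] F} {C : ℝ}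
    (hf : ∀ z, Tendsto (fun k => f k z) atTop (𝓝 (g z)))
    (hA : ∀ k z, ‖f k (x + z) - f k x - A k z‖ ≤ C * ‖z‖ ^ 2)
    (hB : ∀ z, ‖g (x + z) - g x - B z‖ ≤ C * ‖z‖ ^ 2) (z : E) :
    Tendsto (fun k => A k z) atTop (𝓝 (B z)) := by
  rw [Metric.tendsto_atTop]
  intro ε hε
  -- The two remainders at `t • z` add up to at most `2 * C * t² * ‖z‖²`; divided by `t` this falls
  -- below `ε / 2`.
  obtain ⟨t, ht0, ht⟩ : ∃ t : ℝ, 0 < t ∧ 2 * C * ‖z‖ ^ 2 * t < ε / 2 := by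
    have hlim : Tendsto (fun t : ℝ => 2 * C * ‖z‖ ^ 2 * t) (𝓝[>] 0) (𝓝 0) := by
      have : Tendsto (fun t : ℝ => 2 * C * ‖z‖ ^ 2 * t) (𝓝 0) (𝓝 (2 * C * ‖z‖ ^ 2 * 0)) :=
        (continuous_const.mul continuous_id).tendsto 0
      rw [mul_zero] at this
      exact this.mono_left nhdsWithin_le_nhds
    obtain ⟨t, h1, h2⟩ := ((hlim.eventually (gt_mem_nhds (half_pos hε))).and
      self_mem_nhdsWithin).exists
    exact ⟨t, h2, h1⟩
  have hd : Tendsto (fun k => ‖(f k (x + t • z) - f k x) - (g (x + t • z) - g x)‖) atTop (𝓝 0) :=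
    tendsto_iff_norm_sub_tendsto_zero.1 ((hf _).sub (hf _))
  obtain ⟨N, hN⟩ := eventually_atTop.1
    (hd.eventually (gt_mem_nhds (mul_pos ht0 (half_pos hε))))
  refine ⟨N, fun k hk => ?_⟩
  have h1 := hN k hk
  have h2 := hA k (t • z)
  have h3 := hB (t • z)
  rw [norm_smul, Real.norm_of_nonneg ht0.le, map_smul] at h2 h3
  rw [dist_eq_norm]
  have h4 : t * ‖A k z - B z‖ = ‖(f k (x + t • z) - f k x) - (g (x + t • z) - g x)
      - (f k (x + t • z) - f k x - t • A k z) + (g (x + t • z) - g x - t • B z)‖ := by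
    rw [← Real.norm_of_nonneg ht0.le, ← norm_smul, Real.norm_of_nonneg ht0.le, smul_sub]
    congr 1
    abel
  have h5 := (norm_add_le ((f k (x + t • z) - f k x) - (g (x + t • z) - g x)
      - (f k (x + t • z) - f k x - t • A k z)) (g (x + t • z) - g x - t • B z)).trans
      (add_le_add_left (norm_sub_le _ _) _)
  rw [← h4] at h5
  have h6 : t * ‖A k z - B z‖ < t * ε := by nlinarith
  exact lt_of_mul_lt_mul_left h6 ht0.le

/-- Pointwise convergence of linear maps on a finite dimensional space is norm convergence. -/
lemma tendsto_clm_of_tendsto_apply {E F : Type*} [NormedAddCommGroup E] [NormedSpace ℝ E]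
    [FiniteDimensional ℝ E] [NormedAddCommGroup F] [NormedSpace ℝ F]
    {A : ℕ → E →L[ℝ] F} {B : E →L[ℝ] F}
    (h : ∀ z, Tendsto (fun k => A k z) atTop (𝓝 (B z))) : Tendsto A atTop (𝓝 B) := by
  set b := Module.finBasis ℝ E
  obtain ⟨C, -, hC⟩ := b.exists_opNorm_le (F := F)
  rw [tendsto_iff_norm_sub_tendsto_zero]
  have hlim : Tendsto (fun k => C * ∑ i, ‖A k (b i) - B (b i)‖) atTop (𝓝 0) := by
    have := (tendsto_finsetSum Finset.univ fun i _ =>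
      tendsto_iff_norm_sub_tendsto_zero.1 (h (b i))).const_mul C
    simpa using this
  refine squeeze_zero (fun _ => norm_nonneg _) (fun k => ?_) hlim
  refine hC (Finset.sum_nonneg fun i _ => norm_nonneg _) fun i => ?_
  exact Finset.single_le_sum (f := fun i => ‖A k (b i) - B (b i)‖)
    (fun i _ => norm_nonneg _) (Finset.mem_univ i)

/-- The differential of the flow depends continuously on the velocity field, for the weak
topology. -/
lemma C2Bound.tendsto_fderiv_flow (hc : C2Bound n V c) {M : ℝ} {u : ℕ → Velocity V}
    {v : Velocity V} (hu : ∀ k, ‖u k‖ ≤ M)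
    (hlim : ∀ ℓ : Velocity V →L[ℝ] ℝ, Tendsto (fun k => ℓ (u k)) atTop (𝓝 (ℓ v)))
    (x : Eucl n) :
    Tendsto (fun k => fderiv ℝ (flow (u k) 1) x) atTop
      (𝓝 (fderiv ℝ (flow v 1 : Eucl n → Eucl n) x)) := by
  -- One Taylor constant has to serve both the sequence and the limit.
  have hu' : ∀ k, ‖u k‖ ≤ max M ‖v‖ := fun k => (hu k).trans (le_max_left _ _)
  choose A hA using fun k => hc.exists_taylor_flow (hu' k) (hc.isFlow_flow (u k)) x
  obtain ⟨B, hB⟩ := hc.exists_taylor_flow (le_max_right M ‖v‖) (hc.isFlow_flow v) x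
  rw [(hasFDerivAt_of_norm_sub_le_sq hB).fderiv]
  simp only [fun k => (hasFDerivAt_of_norm_sub_le_sq (hA k)).fderiv]
  exact tendsto_clm_of_tendsto_apply
    (tendsto_apply_of_norm_sub_le_sq (hc.tendsto_flow hu hlim) hA hB)

lemma C2Bound.lipschitzWith_flow (hc : C2Bound n V c) {M : ℝ} {v : Velocity V} (hv : ‖v‖ ≤ M) :
    LipschitzWith (Real.toNNReal (2 * Real.exp ((c * M) ^ 2)))
      (flow v 1 : Eucl n → Eucl n) := by
  refine LipschitzWith.of_dist_le_mul fun x y => ?_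
  rw [Real.coe_toNNReal _ (by positivity), dist_eq_norm, dist_eq_norm]
  exact hc.norm_trajectory_sub_le hv ((hc.isFlow_flow v).isTrajectory x)
    ((hc.isFlow_flow v).isTrajectory y) 1 ⟨zero_le_one, le_rfl⟩

lemma C2Bound.norm_fderiv_flow_le (hc : C2Bound n V c) {M : ℝ} {v : Velocity V} (hv : ‖v‖ ≤ M)
    (x : Eucl n) :
    ‖fderiv ℝ (flow v 1 : Eucl n → Eucl n) x‖ ≤ 2 * Real.exp ((c * M) ^ 2) := by
  have := norm_fderiv_le_of_lipschitz ℝ (hc.lipschitzWith_flow hv) (x₀ := x)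
  rwa [Real.coe_toNNReal _ (by positivity)] at this

end

/-! ### Continuity of the pushforward integrand -/

section

variable {n d : ℕ}

/-- Expanded in the standard basis, the wedge product is polynomial in the coordinates. -/
lemma continuous_wedge : Continuous (wedge : (Fin d → Eucl n) → MultiVec n d) := by
  have h : (wedge : (Fin d → Eucl n) → MultiVec n d) = fun u => ∑ r : Fin d → Fin n,
      (∏ i, u i (r i)) • wedge fun i => EuclideanSpace.basisFun (Fin n) ℝ (r i) := by
    funext u
    have hu : u = fun i => ∑ j, u i j • EuclideanSpace.basisFun (Fin n) ℝ j := by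
      funext i
      conv_lhs => rw [← (EuclideanSpace.basisFun (Fin n) ℝ).sum_repr (u i)]
      simp
    conv_lhs => rw [hu]
    have h1 := (exteriorPower.ιMulti ℝ d (M := Eucl n)).toMultilinearMap.map_sum
      (fun i (j : Fin n) => u i j • EuclideanSpace.basisFun (Fin n) ℝ j)
    refine h1.trans (Finset.sum_congr rfl fun r _ => ?_)
    exact (exteriorPower.ιMulti ℝ d (M := Eucl n)).toMultilinearMap.map_smul_univ _ _
  rw [h]
  fun_prop

lemma continuous_wedgeMap_apply (ξ : MultiVec n d) :
    Continuous fun A : Eucl n →L[ℝ] Eucl n => wedgeMap d A ξ := by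
  have hξ : ξ ∈ Submodule.span ℝ (range (exteriorPower.ιMulti ℝ d (M := Eucl n))) := by
    rw [exteriorPower.ιMulti_span]; trivial
  induction hξ using Submodule.span_induction with
  | mem x hx =>
    obtain ⟨u, rfl⟩ := hx
    simp only [wedgeMap_wedge]
    exact continuous_wedge.comp (by fun_prop)
  | zero => simpa using continuous_const
  | add x y _ _ hx hy =>
    simp only [map_add]
    exact hx.add hy
  | smul a x _ hx =>
    simp only [map_smul]
    exact hx.const_smul a

lemma continuous_wedgeMap : Continuous fun q : (Eucl n →L[ℝ] Eucl n) × MultiVec n d =>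
    wedgeMap d q.1 q.2 := by
  set b := Module.finBasis ℝ (MultiVec n d)
  have h : (fun q : (Eucl n →L[ℝ] Eucl n) × MultiVec n d => wedgeMap d q.1 q.2)
      = fun q => ∑ i, b.coord i q.2 • wedgeMap d q.1 (b i) := by
    funext q
    conv_lhs => rw [← b.sum_repr q.2]
    simp only [map_sum, map_smul, Module.Basis.coord_apply]
  rw [h]
  refine continuous_finsetSum _ fun i _ => ?_
  exact ((b.coord i).continuous_of_finiteDimensional.comp continuous_snd).smul
    ((continuous_wedgeMap_apply (b i)).comp continuous_fst)

lemma continuous_wedgeMap_coe :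
    Continuous fun q : (Eucl n →L[ℝ] Eucl n) × OrientedGrassmannian n d =>
      wedgeMap d q.1 (q.2 : MultiVec n d) := by
  have h : Continuous fun q : (Eucl n →L[ℝ] Eucl n) × OrientedGrassmannian n d =>
      (q.1, (q.2 : MultiVec n d)) := by fun_prop
  have h' := (continuous_wedgeMap (n := n) (d := d)).comp h
  exact h'

lemma continuous_jacobianAlong :
    Continuous fun q : (Eucl n →L[ℝ] Eucl n) × OrientedGrassmannian n d =>
      jacobianAlong q.1 q.2 :=
  continuous_wedgeMap_coe.norm

/-- Elements of the Grassmannian are unit vectors, so the pairs `(A, T)` range over a compact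
product of a ball and a sphere. -/
lemma exists_jacobianAlong_le (n d : ℕ) (R : ℝ) : ∃ C : ℝ, ∀ A : Eucl n →L[ℝ] Eucl n, ‖A‖ ≤ R →
    ∀ T : OrientedGrassmannian n d, jacobianAlong A T ≤ C := by
  have : ProperSpace (Eucl n →L[ℝ] Eucl n) := FiniteDimensional.proper ℝ _
  have : ProperSpace (MultiVec n d) := FiniteDimensional.proper ℝ _
  obtain ⟨C, hC⟩ := ((isCompact_closedBall (0 : Eucl n →L[ℝ] Eucl n) R).prod
    (isCompact_sphere (0 : MultiVec n d) 1)).exists_bound_of_continuousOn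
    continuous_wedgeMap.continuousOn
  exact ⟨C, fun A hA T => hC (A, T.1)
    ⟨mem_closedBall_zero_iff.2 hA, mem_sphere_zero_iff_norm.2 T.2.1⟩⟩

lemma continuousAt_grassmannAct {q : (Eucl n →L[ℝ] Eucl n) × OrientedGrassmannian n d}
    (hq : wedgeMap d q.1 q.2.1 ≠ 0) :
    ContinuousAt (fun q : (Eucl n →L[ℝ] Eucl n) × OrientedGrassmannian n d =>
      grassmannAct q.1 q.2) q := by
  have hw := continuous_wedgeMap_coe (n := n) (d := d)
  rw [Topology.IsInducing.subtypeVal.continuousAt_iff]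
  have hq' : ‖wedgeMap d q.1 q.2.1‖ ≠ 0 := norm_ne_zero_iff.2 hq
  have h0 : ContinuousAt (fun q : (Eucl n →L[ℝ] Eucl n) × OrientedGrassmannian n d =>
      ‖wedgeMap d q.1 q.2.1‖) q := hw.norm.continuousAt
  have h1 := h0.inv₀ hq'
  refine (h1.smul hw.continuousAt).congr ?_
  -- Nonvanishing is an open condition, so nearby only the normalizing branch of `grassmannAct`
  -- occurs.
  filter_upwards [hw.continuousAt.eventually_ne hq] with p hp
  rw [Function.comp, grassmannAct, dif_pos hp]
  rfl

/-- The integrand of the pushforward is jointly continuous, including at linear maps that kill the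
subspace, where the Jacobian vanishes. -/
lemma continuous_pushforward_integrand {ω : PhaseSpace n d → ℝ} (hω : Continuous ω) {C : ℝ}
    (hC : ∀ p, ‖ω p‖ ≤ C) :
    Continuous fun q : Eucl n × (Eucl n →L[ℝ] Eucl n) × OrientedGrassmannian n d =>
      ω (q.1, grassmannAct q.2.1 q.2.2) * jacobianAlong q.2.1 q.2.2 := by
  have hJ : Continuous fun q : Eucl n × (Eucl n →L[ℝ] Eucl n) × OrientedGrassmannian n d =>
      jacobianAlong q.2.1 q.2.2 := continuous_jacobianAlong.comp continuous_snd
  refine continuous_iff_continuousAt.2 fun q => ?_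
  -- Where the image vanishes the normalized direction may jump, but boundedness of `ω` lets the
  -- Jacobian squeeze the product to 0.
  by_cases hq : wedgeMap d q.2.1 q.2.2.1 = 0
  · have h0 : jacobianAlong q.2.1 q.2.2 = 0 := by rw [jacobianAlong, hq, norm_zero]
    have hlim := (hJ.const_mul C).tendsto q
    rw [ContinuousAt, h0, mul_zero]
    simp only [h0, mul_zero] at hlim
    refine squeeze_zero_norm (fun p => ?_) hlim
    have hp : 0 ≤ jacobianAlong p.2.1 p.2.2 := norm_nonneg _
    rw [norm_mul, Real.norm_of_nonneg hp]
    exact mul_le_mul_of_nonneg_right (hC _) hp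
  · refine ContinuousAt.mul ?_ hJ.continuousAt
    refine hω.continuousAt.comp (ContinuousAt.prodMk continuousAt_fst ?_)
    exact ContinuousAt.comp (f := Prod.snd) (continuousAt_grassmannAct hq) continuousAt_snd

lemma aestronglyMeasurable_pushforward_integrand {ω : PhaseSpace n d → ℝ} (hω : Continuous ω)
    {C : ℝ} (hC : ∀ p, ‖ω p‖ ≤ C) {φ : Eucl n → Eucl n} (hφ : Continuous φ)
    (μ : Measure (PhaseSpace n d)) :
    AEStronglyMeasurable (fun p : PhaseSpace n d =>
      ω (φ p.1, grassmannAct (fderiv ℝ φ p.1) p.2) * jacobianAlong (fderiv ℝ φ p.1) p.2) μ := by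
  have : ProperSpace (Eucl n →L[ℝ] Eucl n) := FiniteDimensional.proper ℝ _
  have hm : Measurable fun p : PhaseSpace n d => fderiv ℝ φ p.1 :=
    (measurable_fderiv ℝ φ).comp measurable_fst
  have h1 : AEStronglyMeasurable (fun p : PhaseSpace n d => φ p.1) μ :=
    (hφ.comp continuous_fst).aestronglyMeasurable
  have h2 : AEStronglyMeasurable (fun p : PhaseSpace n d => p.2) μ :=
    continuous_snd.aestronglyMeasurable
  exact (continuous_pushforward_integrand hω hC).comp_aestronglyMeasurable
    (h1.prodMk (hm.aestronglyMeasurable.prodMk h2))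

lemma norm_pushforward_integrand_le {ω : PhaseSpace n d → ℝ} {C D : ℝ} (hC : ∀ p, ‖ω p‖ ≤ C)
    {A : Eucl n →L[ℝ] Eucl n} {T : OrientedGrassmannian n d} (hD : jacobianAlong A T ≤ D)
    (x : Eucl n) : ‖ω (x, grassmannAct A T) * jacobianAlong A T‖ ≤ C * D := by
  have h0 : 0 ≤ jacobianAlong A T := norm_nonneg _
  rw [norm_mul, Real.norm_of_nonneg h0]
  exact mul_le_mul (hC _) hD h0 ((norm_nonneg _).trans (hC (x, grassmannAct A T)))

lemma IsC01.continuous {ω : PhaseSpace n d → ℝ} (h : IsC01 ω) : Continuous ω := by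
  have h1 : ω = fun p => toAmbient ω (ambient p) := by
    funext p
    simp [toAmbient, ambient]
  have h2 : Continuous (ambient : PhaseSpace n d → _) :=
    continuous_fst.prodMk (continuous_subtype_val.comp continuous_snd)
  rw [h1]
  exact h.1.continuousOn.comp_continuous h2 fun p => p.2.2

end

/-! ### The registration functional -/

section

variable {n d : ℕ} {V : Type*} [NormedAddCommGroup V] [InnerProductSpace ℝ V]
  [RKHS ℝ V (Eucl n) (Eucl n)] {c : ℝ}

/-- The pushforward of a varifold by the flow is continuous for the weak topology on velocities. -/
lemma C2Bound.tendsto_pushforward_flow (hc : C2Bound n V c) {M : ℝ} {u : ℕ → Velocity V}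
    {v : Velocity V} (hu : ∀ k, ‖u k‖ ≤ M)
    (hlim : ∀ ℓ : Velocity V →L[ℝ] ℝ, Tendsto (fun k => ℓ (u k)) atTop (𝓝 (ℓ v)))
    (μ : Measure (PhaseSpace n d)) [IsFiniteMeasure μ]
    {ω : PhaseSpace n d → ℝ} (hω : Continuous ω) {C : ℝ} (hC : ∀ p, ‖ω p‖ ≤ C) :
    Tendsto (fun k => pushforward (flow (u k) 1) μ ω) atTop
      (𝓝 (pushforward (flow v 1) μ ω)) := by
  obtain ⟨D, hD⟩ := exists_jacobianAlong_le n d (2 * Real.exp ((c * M) ^ 2))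
  refine tendsto_integral_of_dominated_convergence (fun _ => C * D) (fun k => ?_)
    (integrable_const _) (fun k => ae_of_all _ fun p => ?_) (ae_of_all _ fun p => ?_)
  · exact aestronglyMeasurable_pushforward_integrand hω hC
      (hc.lipschitzWith_flow (hu k)).continuous μ
  · exact norm_pushforward_integrand_le hC (hD _ (hc.norm_fderiv_flow_le (hu k) p.1) p.2) _
  · exact ((continuous_pushforward_integrand hω hC).tendsto
      (flow v 1 p.1, fderiv ℝ (flow v 1) p.1, p.2)).comp
      ((hc.tendsto_flow hu hlim p.1).prodMk_nhds
        ((hc.tendsto_fderiv_flow hu hlim p.1).prodMk_nhds tendsto_const_nhds))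

lemma lintegral_enorm_sq_eq (v : Velocity V) :
    ∫⁻ t in Icc (0 : ℝ) 1, ‖v t‖ₑ ^ 2 = ENNReal.ofReal (‖v‖ ^ 2) := by
  rw [← integral_norm_sq_eq, ofReal_integral_eq_lintegral_ofReal
    ((memLp_two_iff_integrable_sq_norm (Lp.aestronglyMeasurable v)).1 (Lp.memLp v))
    (ae_of_all _ fun _ => sq_nonneg _)]
  refine lintegral_congr fun t => ?_
  rw [ENNReal.ofReal_pow (norm_nonneg _), ofReal_norm]

variable (W : Type*) [NormedAddCommGroup W] [InnerProductSpace ℝ W] [RKHS ℝ W (PhaseSpace n d) ℝ]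
  (lam : ℝ≥0) (μ₀ μtar : Measure (PhaseSpace n d))

lemma ofReal_norm_sq_le_energy (v : Velocity V) :
    1 / 2 * ENNReal.ofReal (‖v‖ ^ 2) ≤ energy W lam μ₀ μtar v := by
  rw [energy, lintegral_enorm_sq_eq]
  exact le_self_add

variable {W}

lemma EmbedsInC01.exists_norm_apply_le (hW : EmbedsInC01 n d W) :
    ∃ C : ℝ≥0, ∀ ω : W, ∀ p : PhaseSpace n d, ‖ω p‖ ≤ C * ‖ω‖ := by
  obtain ⟨-, C, hC⟩ := hW
  refine ⟨C, fun ω p => ?_⟩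
  have h := (hC ω p).1
  simp only [enorm_eq_nnnorm] at h
  exact_mod_cast h

/-- Test functions in the unit ball of `W` are uniformly bounded, the Jacobian of the flow is
bounded and both measures are finite. Finiteness of the infimum, needed to extract a minimizing
sequence, follows. -/
lemma C2Bound.energy_lt_top (hc : C2Bound n V c) (hW : EmbedsInC01 n d W)
    [IsFiniteMeasure μ₀] [IsFiniteMeasure μtar] (v : Velocity V) :
    energy W lam μ₀ μtar v < ∞ := by
  obtain ⟨C, hC⟩ := hW.exists_norm_apply_le
  obtain ⟨D, hD⟩ := exists_jacobianAlong_le n d (2 * Real.exp ((c * ‖v‖) ^ 2))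
  rw [energy, lintegral_enorm_sq_eq]
  refine ENNReal.add_lt_top.2 ⟨ENNReal.mul_lt_top (by simp) ENNReal.ofReal_lt_top,
    ENNReal.mul_lt_top ENNReal.coe_lt_top (ENNReal.pow_lt_top ?_)⟩
  refine lt_of_le_of_lt (b := ENNReal.ofReal (C * D * μ₀.real univ + C * μtar.real univ)) ?_
    ENNReal.ofReal_lt_top
  refine iSup₂_le fun ω hω => ?_
  have hω1 : ∀ p, ‖ω p‖ ≤ C := fun p => (hC ω p).trans
    (mul_le_of_le_one_right C.2 (mem_closedBall_zero_iff.1 hω))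
  rw [← ofReal_norm]
  refine ENNReal.ofReal_le_ofReal ((norm_sub_le _ _).trans (add_le_add ?_ ?_))
  · exact norm_integral_le_of_norm_le_const (ae_of_all _ fun p =>
      norm_pushforward_integrand_le hω1 (hD _ (hc.norm_fderiv_flow_le le_rfl p.1) p.2) _)
  · exact norm_integral_le_of_norm_le_const (ae_of_all _ hω1)

/-- The energy is sequentially lower semicontinuous for the weak topology. -/
lemma C2Bound.energy_le_of_tendsto (hc : C2Bound n V c) (hW : EmbedsInC01 n d W)
    [IsFiniteMeasure μ₀] {M : ℝ} {u : ℕ → Velocity V}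
    {v : Velocity V} (hu : ∀ k, ‖u k‖ ≤ M)
    (hlim : ∀ ℓ : Velocity V →L[ℝ] ℝ, Tendsto (fun k => ℓ (u k)) atTop (𝓝 (ℓ v)))
    {m : ℝ≥0∞} (hm : Tendsto (fun k => energy W lam μ₀ μtar (u k)) atTop (𝓝 m)) :
    energy W lam μ₀ μtar v ≤ m := by
  obtain ⟨C, hC⟩ := hW.exists_norm_apply_le
  set L : Velocity V → W → ℝ := fun w ω => pushforward (flow w 1) μ₀ ω - pairing μtar ω with hL
  -- The test function is fixed before passing to the limit, so no uniformity in `ω` is needed.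
  have key : ∀ ω : Metric.closedBall (0 : W) 1,
      1 / 2 * ENNReal.ofReal (‖v‖ ^ 2) + lam * ‖L v ω‖ₑ ^ 2 ≤ m := by
    intro ω
    -- By `0 ≤ ‖v - u k‖²`, this expression is at most `‖u k‖²`; being affine in `u k`, it passes to
    -- the weak limit.
    have h1 : Tendsto (fun k => 2 * inner ℝ v (u k) - ‖v‖ ^ 2) atTop (𝓝 (‖v‖ ^ 2)) := by
      have := ((hlim (innerSL ℝ v)).const_mul 2).sub_const (‖v‖ ^ 2)
      simp only [innerSL_apply_apply, real_inner_self_eq_norm_sq] at this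
      convert this using 2
      ring
    have h2 : Tendsto (fun k => L (u k) ω) atTop (𝓝 (L v ω)) :=
      (hc.tendsto_pushforward_flow hu hlim μ₀ (hW.1 ω).continuous (hC ω)).sub_const _
    have h3 := ENNReal.Tendsto.const_mul (a := 1 / 2) (ENNReal.tendsto_ofReal h1)
      (Or.inr (by simp))
    have h4 := ENNReal.Tendsto.const_mul (a := (lam : ℝ≥0∞)) (ENNReal.Tendsto.pow (n := 2) h2.enorm)
      (Or.inr ENNReal.coe_ne_top)
    refine le_of_tendsto_of_tendsto' (h3.add h4) hm fun k => ?_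
    rw [energy, lintegral_enorm_sq_eq]
    gcongr
    · have := norm_sub_sq_real v (u k)
      nlinarith [sq_nonneg ‖v - u k‖]
    · exact le_iSup₂ (f := fun (ω : W) (_ : ω ∈ Metric.closedBall (0 : W) 1) => ‖L (u k) ω‖ₑ)
        (ω : W) ω.2
  have hne : Nonempty (Metric.closedBall (0 : W) 1) := ⟨⟨0, by simp⟩⟩
  -- Continuity and monotonicity allow the supremum over `ω` to be pulled out of the square and the
  -- sum.
  have hcont : Continuous fun x : ℝ≥0∞ => 1 / 2 * ENNReal.ofReal (‖v‖ ^ 2) + lam * x ^ 2 :=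
    continuous_const.add ((ENNReal.continuous_const_mul ENNReal.coe_ne_top).comp
      (ENNReal.continuous_pow 2))
  have hmono : Monotone fun x : ℝ≥0∞ => 1 / 2 * ENNReal.ofReal (‖v‖ ^ 2) + lam * x ^ 2 :=
    fun x y hxy => by dsimp only; gcongr
  rw [energy, lintegral_enorm_sq_eq, dualNorm, iSup_subtype']
  exact (hmono.map_ciSup_of_continuousAt hcont.continuousAt).trans_le (iSup_le key)

/-- Existence of a minimizer of the energy, by the direct method. -/
lemma C2Bound.exists_energy_minimizer [CompleteSpace V] (hc : C2Bound n V c)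
    (hW : EmbedsInC01 n d W) [IsFiniteMeasure μ₀] [IsFiniteMeasure μtar] :
    ∃ v : Velocity V, ∀ u : Velocity V, energy W lam μ₀ μtar v ≤ energy W lam μ₀ μtar u := by
  set m : ℝ≥0∞ := ⨅ u : Velocity V, energy W lam μ₀ μtar u with hm
  have hmtop : m ≠ ∞ :=
    ((iInf_le _ 0).trans_lt (hc.energy_lt_top lam μ₀ μtar hW 0)).ne
  have hex : ∀ k : ℕ, ∃ u : Velocity V,
      energy W lam μ₀ μtar u < m + ((k + 1 : ℕ) : ℝ≥0∞)⁻¹ := fun k =>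
    iInf_lt_iff.1 (ENNReal.lt_add_right hmtop (by simp))
  choose u hu using hex
  have htend : Tendsto (fun k => energy W lam μ₀ μtar (u k)) atTop (𝓝 m) := by
    have h1 : Tendsto (fun k : ℕ => m + ((k + 1 : ℕ) : ℝ≥0∞)⁻¹) atTop (𝓝 (m + 0)) :=
      tendsto_const_nhds.add
        (ENNReal.tendsto_inv_nat_nhds_zero.comp (tendsto_add_atTop_nat 1))
    rw [add_zero] at h1
    exact tendsto_of_tendsto_of_tendsto_of_le_of_le tendsto_const_nhds h1
      (fun k => iInf_le _ _) fun k => (hu k).le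
  -- From `½ ‖u k‖² ≤ E(u k) ≤ m + 1`, as the excess `1 / (k + 1)` is at most 1.
  have hbound : ∀ k, ‖u k‖ ≤ √(2 * (m + 1)).toReal := by
    intro k
    refine Real.le_sqrt_of_sq_le ?_
    rw [← ENNReal.ofReal_le_iff_le_toReal
      (ENNReal.mul_ne_top (by simp) (ENNReal.add_ne_top.2 ⟨hmtop, by simp⟩))]
    have h1 : 1 / 2 * ENNReal.ofReal (‖u k‖ ^ 2) ≤ m + 1 :=
      (ofReal_norm_sq_le_energy W lam μ₀ μtar (u k)).trans ((hu k).le.trans (by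
        gcongr
        rw [ENNReal.inv_le_one]
        exact_mod_cast Nat.succ_le_succ (Nat.zero_le k)))
    calc ENNReal.ofReal (‖u k‖ ^ 2) = 2 * (1 / 2 * ENNReal.ofReal (‖u k‖ ^ 2)) := by
          rw [← mul_assoc, one_div, ENNReal.mul_inv_cancel (by simp) (by simp), one_mul]
      _ ≤ 2 * (m + 1) := by gcongr
  obtain ⟨v, σ, hσ, hlim⟩ := exists_weakly_convergent_subseq u hbound
  refine ⟨v, fun w => le_trans ?_ (iInf_le _ w)⟩
  exact hc.energy_le_of_tendsto lam μ₀ μtar hW (fun k => hbound (σ k)) hlim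
    (htend.comp hσ.tendsto_atTop)

end

end Varifold

end

theorem mainTheorem2 (n d : ℕ)
    (V : Type*) [NormedAddCommGroup V] [InnerProductSpace ℝ V] [CompleteSpace V]
    [RKHS ℝ V (Varifold.Eucl n) (Varifold.Eucl n)]
    (W : Type*) [NormedAddCommGroup W] [InnerProductSpace ℝ W] [CompleteSpace W]
    [RKHS ℝ W (Varifold.PhaseSpace n d) ℝ]
    (hV : Varifold.EmbedsInC02 n V) (hW : Varifold.EmbedsInC01 n d W)
    (lam : ℝ≥0)
    (μ₀ μtar : Measure (Varifold.PhaseSpace n d)) [IsFiniteMeasure μ₀] [IsFiniteMeasure μtar]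
    (K : Set (Varifold.PhaseSpace n d)) (hK : IsCompact K) (hμ₀ : μ₀.support ⊆ K) :
    -- every velocity field has a flow, unique on `[0,1]`, so that the functional is well defined
    (∀ u : Varifold.Velocity V, Varifold.IsFlow u (Varifold.flow u) ∧
      ∀ φ, Varifold.IsFlow u φ → ∀ t ∈ Icc (0 : ℝ) 1, φ t = Varifold.flow u t) ∧
    -- and there is a global minimizer, of finite energy
    ∃ v : Varifold.Velocity V, Varifold.energy W lam μ₀ μtar v < ∞ ∧
      ∀ u : Varifold.Velocity V,
        Varifold.energy W lam μ₀ μtar v ≤ Varifold.energy W lam μ₀ μtar u := by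
  obtain ⟨c, hc⟩ := hV.exists_bound
  refine ⟨fun u => ⟨hc.isFlow_flow u, fun φ hφ => hc.isFlow_unique hφ (hc.isFlow_flow u)⟩, ?_⟩
  obtain ⟨v, hv⟩ := hc.exists_energy_minimizer lam μ₀ μtar hW
  exact ⟨v, hc.energy_lt_top lam μ₀ μtar hW v, hv⟩
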